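/- Let $d\ge 2$, $G=\mathrm{SL}(d,\mathbb R)$, $\Gamma=\mathrm{SL}(d,\mathbb Z)$, $E^t=\operatorname{diag}(e^{-t},\dots,e^{-t},e^{(d-1)t})$, and let $\|\cdot\|$ be any norm on $\mathbb R^d$; write $\|\cdot\|$ also for the induced operator norm on matrices. Let $F\subset G$ be a fundamental domain of the left action of $\Gamma$ on $G$ (that is, $\bigcup_{P\in\Gamma}PF=G$ and $F\cap PF=\emptyset$ for $P\neq 1$) contained in a Siegel set $$\{nak:\ n\in F_N,\ a=\operatorname{diag}(a_1,\dots,a_d),\ a_j>0,\ \textstyle\prod_j a_j=1,\ a_j\ge\tfrac{\sqrt3}{2}a_{j+1}\ (1\le j<d),\ k\in \mathrm{SO}(d)\},$$ where $F_N$ is a compact subset of the group $N$ of upper triangular unipotent matrices whose translates by $\Gamma\cap N$ cover $N$. Let $\alpha\in\mathbb R^{d-1}$ and let $$M=\begin{pmatrix}1&\alpha\\0&1\end{pmatrix}\begin{pmatrix}A&0\\ {}^{t}b&\gamma\end{pmatrix}\in G,\qquad A\in \mathrm{Mat}_{d-1}(\mathbb R),\ b\in\mathbb R^{d-1},\ \gamma>0,$$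 so that the last column of $M$ is $\gamma\,\omega$ with $\omega=\binom{\alpha}{1}$. For $t\ge0$ let $P(t)\in\Gamma$ be the unique element with $P(t)ME^t\in F$. Given times $0=t_0<t_1<t_2<\cdots\to\infty$ with $P(t_n)\ne P(t_{n-1})$ for $n\ge1$, put $\delta t_n=t_n-t_{n-1}$, $P^{(n)}=P(t_n)$, $M^{(n)}=P^{(n)}ME^{t_n}$, $T^{(n)}=P^{(n)}(P^{(n-1)})^{-1}$, $\gamma^{(n)}=(M^{(n)})_{dd}$, $\omega^{(n)}=(\gamma^{(n)})^{-1}M^{(n)}(0,\dots,0,1)^{t}$, $\lambda_n=\frac{\gamma}{\gamma^{(n)}}e^{(d-1)t_n}$ and $\eta_n=\lambda_n/\lambda_{n-1}$. (If $M\in F$, then $M^{(0)}=M$, $\omega^{(0)}=\omega$ and $\lambda_0=1$.) Given widths $0<\sigma_n<1$ ($n\ge0$) and constants $\nu,\delta>0$, $0<\lambda<1$, put $I_n^+=\{k\in\mathbb Z^d: |k\cdot\omega^{(n)}|\le\sigma_n\|k\|\}$ and $$A_n=\sup_{k\in I_n^+\setminus\{0\}}\frac{\|{}^{t}(T^{(n+1)})^{-1}k\|}{\|k\|},\qquad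 B_n=\prod_{i=0}^nA_i,\qquad \varepsilon_n=\frac{\sigma_n}{42}\min\Big\{\frac{\nu}{4\pi},\frac{\sigma_n}{72\|\omega^{(n)}\|}\Big\},$$ $$\Theta_n=\min\left\{\varepsilon_n,\ \frac{\lambda^n\sigma_n^2}{\prod_{i=1}^n\|(T^{(i)})^{-1}\|^2},\ \lambda^n\,\frac{\frac{\sigma_n|\gamma^{(n)}|}{\|M^{(n)}\|}-\frac{\sigma_{n+1}|\gamma^{(n+1)}|}{e^{d\,\delta t_{n+1}}\|M^{(n+1)}\|}}{1+|\gamma^{(n)}|\,\|(M^{(n)})^{-1}\|}\right\},$$ $$\phi_n=\max\Big\{2|\eta_n|\,\|T^{(n)}\|\,(1+2\pi\delta^{-1})\frac{\Theta_{n-1}}{\Theta_n},\,1\Big\}\ (n\ge 1),\qquad \mathcal B(\omega)=\sum_{i=0}^\infty B_i\log\phi_{i+1}+(\delta+\nu)\sum_{i=0}^\infty B_i\in[0,\infty].$$ **Lemma.** For every $\epsilon>0$ there are constants $\xi,c>0$ depending only on $d$ and $\epsilon$ with the following property. Let $\|\cdot\|,F_N,F$ be as above, let $\alpha$ be Diophantine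 with exponent $\epsilon$, i.e. for some $C>0$ $$|m|^{(d-1)(1+\epsilon)}\,|m\cdot\alpha+k|>C\qquad\text{for all } m\in\mathbb Z^{d-1}\setminus\{0\},\ k\in\mathbb Z$$ ($|\cdot|$ the maximum norm), let $M$ be as above with this $\alpha$, and let $\nu,\delta>0$, $0<\lambda<1$. Then there are times $0=t_0<t_1<t_2<\cdots\to\infty$ with $P(t_n)\neq P(t_{n-1})$ for all $n\ge1$ and widths $0<\sigma_n<1$ such that $\delta t_n=\xi\,t_{n-1}$ for all $n\ge2$, $\sigma_n=e^{-c\,\delta t_n}$ for all $n\ge1$, $\Theta_n>0$ for all $n\ge0$, and $\mathcal B(\omega)<\infty$. -/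

import Mathlib

open scoped ENNReal

noncomputable section

namespace MCF

/-- `G = SL(d, ℝ)` with `d = m + 1`. -/
abbrev G (m : ℕ) := Matrix.SpecialLinearGroup (Fin (m + 1)) ℝ

/-- `Γ = SL(d, ℤ)` with `d = m + 1`. -/
abbrev Gam (m : ℕ) := Matrix.SpecialLinearGroup (Fin (m + 1)) ℤ

/-- The inclusion of `Γ` in `G`. -/
def incl {m : ℕ} : Gam m →* G m := Matrix.SpecialLinearGroup.map (Int.castRingHom ℝ)

/-! ### The flow on the homogeneous space -/

/-- The exponents `-1, …, -1, d - 1`. -/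
def rate (m : ℕ) : Fin (m + 1) → ℝ := Fin.snoc (α := fun _ => ℝ) (fun _ : Fin m => -1) (m : ℝ)

lemma sum_rate (m : ℕ) : ∑ i, rate m i = 0 := by
  simp [rate, Fin.sum_univ_castSucc]

/-- `E^t = diag(e^{-t}, …, e^{-t}, e^{(d-1)t})`. -/
def E (m : ℕ) (t : ℝ) : G m :=
  ⟨Matrix.diagonal fun i => Real.exp (rate m i * t), by
    rw [Matrix.det_diagonal, ← Real.exp_sum, ← Finset.sum_mul, sum_rate, zero_mul, Real.exp_zero]⟩

/-- `F` is a (strict) fundamental domain of the left action of `Γ` on `G`. -/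
structure IsFundDomain {m : ℕ} (F : Set (G m)) : Prop where
  covers : ⋃ P : Gam m, (fun g => incl P * g) '' F = Set.univ
  disjoint : ∀ P : Gam m, P ≠ 1 → F ∩ ((fun g => incl P * g) '' F) = ∅

/-- The group `N` of upper triangular unipotent matrices. -/
def unipotent (m : ℕ) : Set (G m) :=
  {n | (∀ i, n i i = 1) ∧ ∀ i j, j < i → n i j = 0}

/-- `FN` is compact, lies in `N`, and its translates by `Γ ∩ N` cover `N`.  (Nothing is asked about
overlaps of translates, so every compact fundamental region of `(Γ ∩ N) \ N` is allowed.) -/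
structure IsCompactRegion {m : ℕ} (FN : Set (G m)) : Prop where
  subset : FN ⊆ unipotent m
  compact : IsCompact FN
  covers : ∀ n ∈ unipotent m, ∃ P : Gam m, incl P ∈ unipotent m ∧ incl P * n ∈ FN

/-- The Siegel set of matrices `n a k` with `n ∈ FN`, `a` a positive diagonal matrix of determinant
one with `a_j ≥ (√3/2) a_{j+1}`, and `k ∈ SO(d)`. -/
def siegelSet {m : ℕ} (FN : Set (G m)) : Set (G m) :=
  {g | ∃ n ∈ FN, ∃ a : Fin (m + 1) → ℝ, ∃ k ∈ Matrix.specialOrthogonalGroup (Fin (m + 1)) ℝ,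
    (∀ j, 0 < a j) ∧ ∏ j, a j = 1 ∧
    (∀ j : Fin m, Real.sqrt 3 / 2 * a j.succ ≤ a j.castSucc) ∧
    (g : Matrix (Fin (m + 1)) (Fin (m + 1)) ℝ) = n.1 * Matrix.diagonal a * k}

/-- The matrix `(1 α; 0 1) (A 0; βᵀ γ)`. -/
def paramMatrix {m : ℕ} (α : Fin m → ℝ) (A : Matrix (Fin m) (Fin m) ℝ) (β : Fin m → ℝ) (γ : ℝ) :
    Matrix (Fin (m + 1)) (Fin (m + 1)) ℝ :=
  Matrix.reindex finSumFinEquiv finSumFinEquiv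
    (Matrix.fromBlocks 1 (Matrix.replicateCol (Fin 1) α) 0 1 *
      Matrix.fromBlocks A 0 (Matrix.replicateRow (Fin 1) β) (Matrix.diagonal fun _ => γ))

/-- `α ∈ ℝ^{d-1}` is Diophantine with exponent `ε`; here `‖·‖` is the maximum norm. -/
def IsDiophantine {m : ℕ} (α : Fin m → ℝ) (ε : ℝ) : Prop :=
  ∃ C : ℝ, 0 < C ∧ ∀ k : Fin m → ℤ, k ≠ 0 → ∀ l : ℤ,
    C < ‖fun i => (k i : ℝ)‖ ^ ((m : ℝ) * (1 + ε)) * |∑ i, (k i : ℝ) * α i + (l : ℝ)|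

/-- The matrix `P(t) ∈ Γ` with `P(t) M E^t ∈ F`. For a fundamental domain `F` it exists and is unique,
see `cfP_mem` and `cfP_unique`. -/
def cfP {m : ℕ} (F : Set (G m)) (M : G m) (t : ℝ) : Gam m :=
  Classical.epsilon fun P : Gam m => incl P * M * E m t ∈ F

theorem cfP_mem {m : ℕ} {F : Set (G m)} (hF : IsFundDomain F) (M : G m) (t : ℝ) :
    incl (cfP F M t) * M * E m t ∈ F := by
  refine Classical.epsilon_spec (p := fun P : Gam m => incl P * M * E m t ∈ F) ?_
  have h : M * E m t ∈ ⋃ P : Gam m, (fun g => incl P * g) '' F := by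
    rw [hF.covers]; trivial
  obtain ⟨P, f, hf, hPf⟩ := Set.mem_iUnion.1 h
  refine ⟨P⁻¹, ?_⟩
  have hPf' : incl P * f = M * E m t := hPf
  rw [mul_assoc, ← hPf', map_inv, inv_mul_cancel_left]
  exact hf

theorem cfP_unique {m : ℕ} {F : Set (G m)} (hF : IsFundDomain F) (M : G m) (t : ℝ) (P : Gam m)
    (hP : incl P * M * E m t ∈ F) : P = cfP F M t := by
  by_contra hne
  have h := hF.disjoint (P * (cfP F M t)⁻¹) (by rwa [Ne, mul_inv_eq_one])
  have hmem : incl P * M * E m t ∈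
      F ∩ ((fun g => incl (P * (cfP F M t)⁻¹) * g) '' F) := by
    refine ⟨hP, _, cfP_mem hF M t, ?_⟩
    simp [mul_assoc]
  rw [h] at hmem
  exact hmem

/-! ### Quantities of the renormalization scheme

`F` is the fundamental domain, `M ∈ G` the initial matrix, `t` the sequence of stopping times, `σ` the
sequence of cone widths and `N` the norm on `ℝ^d`.  Objects indexed from `1` on in the mathematics
(`δt_n`, `T^{(n)}`, `η_n`, `φ_n`) are only used for `n ≥ 1`. -/

section Scheme

variable {m : ℕ} (N : Seminorm ℝ (Fin (m + 1) → ℝ)) (F : Set (G m)) (M : G m) (t σ : ℕ → ℝ)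

/-- The matrix norm `sup_{x ≠ 0} ‖B x‖ / ‖x‖` induced by the norm `N`. -/
def opNorm (B : Matrix (Fin (m + 1)) (Fin (m + 1)) ℝ) : ℝ :=
  sSup {r | ∃ x : Fin (m + 1) → ℝ, x ≠ 0 ∧ r = N (B.mulVec x) / N x}

/-- `δt_n = t_n - t_{n-1}`, for `n ≥ 1`. -/
def dt (n : ℕ) : ℝ := t n - t (n - 1)

/-- `P^{(n)} = P(t_n)`. -/
def Pn (n : ℕ) : Gam m := cfP F M (t n)

/-- `M^{(n)} = P^{(n)} M E^{t_n}`. -/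
def Mn (n : ℕ) : G m := incl (Pn F M t n) * M * E m (t n)

/-- The transfer matrix `T^{(n)}`, defined by `P^{(n)} = T^{(n)} P^{(n-1)}`, for `n ≥ 1`. -/
def Tn (n : ℕ) : G m := incl (Pn F M t n * (Pn F M t (n - 1))⁻¹)

/-- The parameter `γ` of a matrix: its lower right entry. -/
def gam (g : G m) : ℝ := g (Fin.last m) (Fin.last m)

/-- `γ^{(n)}`. -/
def gamn (n : ℕ) : ℝ := gam (Mn F M t n)

/-- `ω^{(n)} = (γ^{(n)})⁻¹ M^{(n)} (0, …, 0, 1)ᵀ`. -/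
def omn (n : ℕ) : Fin (m + 1) → ℝ :=
  (gamn F M t n)⁻¹ • (Mn F M t n).1.mulVec (Pi.single (Fin.last m) 1)

/-- `λ_n = (γ / γ^{(n)}) e^{(d-1) t_n}`; for `t_0 = 0` and `M = M^{(0)}` this gives `λ_0 = 1`. -/
def lamn (n : ℕ) : ℝ := gam M / gamn F M t n * Real.exp ((m : ℝ) * t n)

/-- `η_n = λ_n / λ_{n-1}`, for `n ≥ 1`. -/
def etan (n : ℕ) : ℝ := lamn F M t n / lamn F M t (n - 1)

/-- The resonant cone `I_n^+`: the `k ∈ ℤ^d` with `|k · ω^{(n)}| ≤ σ_n ‖k‖`. -/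
def resCone (n : ℕ) : Set (Fin (m + 1) → ℤ) :=
  {k | |∑ i, (k i : ℝ) * omn F M t n i| ≤ σ n * N (fun i => (k i : ℝ))}

/-- `A_n = sup_{k ∈ I_n^+ - {0}} ‖(T^{(n+1)})⁻ᵀ k‖ / ‖k‖`. -/
def An (n : ℕ) : ℝ :=
  sSup {r | ∃ k ∈ resCone N F M t σ n, k ≠ 0 ∧
    r = N (((Tn F M t (n + 1))⁻¹).1.transpose.mulVec (fun i => (k i : ℝ))) / N (fun i => (k i : ℝ))}

/-- `B_n = ∏_{i=0}^n A_i`. -/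
def Bn (n : ℕ) : ℝ := ∏ i ∈ Finset.range (n + 1), An N F M t σ i

/-- `ε_n = (σ_n / 42) min {ν / (4π), σ_n / (72 ‖ω^{(n)}‖)}`. -/
def epsn (ν : ℝ) (n : ℕ) : ℝ :=
  σ n / 42 * min (ν / (4 * Real.pi)) (σ n / (72 * N (omn F M t n)))

/-- `σ_n |γ^{(n)}| / ‖M^{(n)}‖`. -/
def width (n : ℕ) : ℝ := σ n * |gamn F M t n| / opNorm N (Mn F M t n).1

/-- `Θ_n`, the minimum of three quantities. -/
def Thetan (ν lam : ℝ) (n : ℕ) : ℝ :=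
  min (epsn N F M t σ ν n)
    (min
      (lam ^ n * σ n ^ 2 / ∏ i ∈ Finset.Icc 1 n, opNorm N ((Tn F M t i)⁻¹).1 ^ 2)
      (lam ^ n *
        ((width N F M t σ n -
            width N F M t σ (n + 1) / Real.exp (((m : ℝ) + 1) * dt t (n + 1))) /
          (1 + |gamn F M t n| * opNorm N ((Mn F M t n)⁻¹).1))))

/-- `φ_n = max {2 |η_n| ‖T^{(n)}‖ (1 + 2π/δ) Θ_{n-1} / Θ_n, 1}`, for `n ≥ 1`. -/
def phin (ν δ lam : ℝ) (n : ℕ) : ℝ :=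
  max (2 * |etan F M t n| * opNorm N (Tn F M t n).1 * (1 + 2 * Real.pi / δ) *
    (Thetan N F M t σ ν lam (n - 1) / Thetan N F M t σ ν lam n)) 1

/-- `𝓑 = ∑_{i ≥ 0} B_i log φ_{i+1} + (δ + ν) ∑_{i ≥ 0} B_i ∈ [0, ∞]`; all terms are nonnegative. -/
def calB (ν δ lam : ℝ) : ℝ≥0∞ :=
  ∑' i, ENNReal.ofReal (Bn N F M t σ i * Real.log (phin N F M t σ ν δ lam (i + 1))) +
    ENNReal.ofReal (δ + ν) * ∑' i, ENNReal.ofReal (Bn N F M t σ i)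

end Scheme

end MCF

end

/-! Everything follows from one bound on the orbit of `M`: for Diophantine `α`, `P(t) M E^t` enters
the cusp at a rate `θ < 1` slower than the expansion `e^t` of `E^{-t}`.

Let `d = m + 1` and let `k` be the last row of some `P ∈ Γ`. If every entry of `k M E^t` were below
`c e^{-θt}`, then `k` would have size at most `e^{(1-θ)t}`, and the Diophantine condition would
bound `|k · ω|` below by a multiple of `e^{-(1-θ)m(1+ε)t}`. With `m(1+ε)(1-θ) = m + θ` this
contradicts the size of the last entry `γ e^{mt} (k · ω)` (`exists_lower_last_row`). In a Siegel set
a lower bound on the last row controls all diagonal factors, hence the matrix and its inverse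
(`siegelSet_entrySum_le`). So `M^{(n)}`, its inverse and `1/γ^{(n)}` grow at most like `e^{mθt_n}`,
`e^{θt_n}`, `e^{χt_n}` up to constants (`orbit_bounds`).

On a thin resonant cone, `(T^{(n+1)})^{-T}` is `E^{δt_{n+1}}` between two such matrices, acting on a
vector whose expanding coordinate is tiny. Hence `A_n` is at most a constant times `exp(-(δt_{n+1} -
θt_{n+1} - mθt_n))` (`OrbitBound.An_le`). When `δt_{n+1} = ξ t_n` with `ξ` large in terms of `θ`,
this exponent is a negative multiple of `t_n`, so the contraction beats the factor `1 + ξ` by which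
the times grow, and `B_n t_{n+1}` decays geometrically.

All other quantities, including `1/Θ_n` and hence `φ_n`, are at most exponential in `t_n`
(`OrbitBound.expBdd_phin`). Thus `log φ_{n+1}` is at most a multiple of `t_{n+1}` and both series
converge (`calB_lt_top`). The constants `ξ` and `c` depend only on `d` and `ε`; every constant
coming from the norm, the Siegel set or `M` is absorbed by a large first time `t_1 = s`. -/

noncomputable section

namespace MCF

/-! ### A submultiplicative entrywise norm on matrices. -/

section EntrySum

variable {n : Type*} [Fintype n]

/-- The sum of the absolute values of the entries of a real matrix. -/
def entrySum (B : Matrix n n ℝ) : ℝ := ∑ i, ∑ j, |B i j|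

lemma entrySum_nonneg (B : Matrix n n ℝ) : 0 ≤ entrySum B :=
  Finset.sum_nonneg fun _ _ => Finset.sum_nonneg fun _ _ => abs_nonneg _

lemma abs_le_entrySum (B : Matrix n n ℝ) (i j : n) : |B i j| ≤ entrySum B :=
  (Finset.single_le_sum (f := fun j => |B i j|) (fun _ _ => abs_nonneg _)
    (Finset.mem_univ j)).trans
    (Finset.single_le_sum (f := fun i => ∑ j, |B i j|)
      (fun _ _ => Finset.sum_nonneg fun _ _ => abs_nonneg _) (Finset.mem_univ i))

lemma entrySum_transpose (B : Matrix n n ℝ) : entrySum B.transpose = entrySum B :=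
  Finset.sum_comm

lemma entrySum_mul_le (A B : Matrix n n ℝ) : entrySum (A * B) ≤ entrySum A * entrySum B := by
  have h : ∀ i, ∑ j, |(A * B) i j| ≤ (∑ k, |A i k|) * entrySum B := by
    intro i
    calc ∑ j, |(A * B) i j| ≤ ∑ j, ∑ k, |A i k| * |B k j| := by
          refine Finset.sum_le_sum fun j _ => ?_
          rw [Matrix.mul_apply]
          exact (Finset.abs_sum_le_sum_abs _ _).trans_eq (by simp only [abs_mul])
      _ = ∑ k, |A i k| * ∑ j, |B k j| := by
          rw [Finset.sum_comm]; simp only [Finset.mul_sum]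
      _ ≤ ∑ k, |A i k| * entrySum B := by
          refine Finset.sum_le_sum fun k _ => mul_le_mul_of_nonneg_left ?_ (abs_nonneg _)
          exact Finset.single_le_sum (f := fun i => ∑ j, |B i j|)
            (fun _ _ => Finset.sum_nonneg fun _ _ => abs_nonneg _) (Finset.mem_univ k)
      _ = _ := by rw [Finset.sum_mul]
  calc entrySum (A * B) ≤ ∑ i, (∑ k, |A i k|) * entrySum B := Finset.sum_le_sum fun i _ => h i
    _ = _ := by rw [← Finset.sum_mul]; rfl

lemma entrySum_diagonal [DecidableEq n] (a : n → ℝ) :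
    entrySum (Matrix.diagonal a) = ∑ i, |a i| := by
  unfold entrySum
  refine Finset.sum_congr rfl fun i _ => ?_
  rw [Finset.sum_eq_single i]
  · simp
  · intro j _ hj; simp [Matrix.diagonal_apply_ne _ hj.symm]
  · simp

lemma entrySum_le_of_abs_le {B : Matrix n n ℝ} {c : ℝ} (h : ∀ i j, |B i j| ≤ c) :
    entrySum B ≤ (Fintype.card n : ℝ) ^ 2 * c := by
  calc entrySum B ≤ ∑ _i : n, ∑ _j : n, c :=
        Finset.sum_le_sum fun i _ => Finset.sum_le_sum fun j _ => h i j
    _ = _ := by simp; ring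

lemma norm_mulVec_le (B : Matrix n n ℝ) (x : n → ℝ) : ‖B.mulVec x‖ ≤ entrySum B * ‖x‖ := by
  rw [pi_norm_le_iff_of_nonneg (mul_nonneg (entrySum_nonneg B) (norm_nonneg x))]
  intro i
  calc ‖B.mulVec x i‖ ≤ ∑ j, |B i j| * ‖x‖ := by
        rw [Real.norm_eq_abs]
        refine (Finset.abs_sum_le_sum_abs _ _).trans (Finset.sum_le_sum fun j _ => ?_)
        rw [abs_mul]
        exact mul_le_mul_of_nonneg_left (norm_le_pi_norm x j) (abs_nonneg _)
    _ = (∑ j, |B i j|) * ‖x‖ := by rw [Finset.sum_mul]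
    _ ≤ _ := mul_le_mul_of_nonneg_right (Finset.single_le_sum (f := fun i => ∑ j, |B i j|)
        (fun _ _ => Finset.sum_nonneg fun _ _ => abs_nonneg _) (Finset.mem_univ i)) (norm_nonneg _)

end EntrySum

/-! ### Siegel sets -/

lemma abs_entry_le_one_of_orthogonal {m : ℕ} {k : Matrix (Fin (m + 1)) (Fin (m + 1)) ℝ}
    (hk : k ∈ Matrix.specialOrthogonalGroup (Fin (m + 1)) ℝ) (i j : Fin (m + 1)) : |k i j| ≤ 1 := by
  have h := entry_norm_bound_of_unitary (𝕜 := ℝ)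
    ((Matrix.mem_specialOrthogonalGroup_iff.1 hk).1) i j
  simpa using h

lemma IsCompactRegion.exists_bound {m : ℕ} {FN : Set (G m)} (h : IsCompactRegion FN) :
    ∃ X : ℝ, 0 < X ∧ ∀ n ∈ FN, entrySum n.1 ≤ X ∧ entrySum (n⁻¹).1 ≤ X := by
  have hc : Continuous fun n : G m => entrySum n.1 := by
    unfold entrySum
    refine continuous_finsetSum _ fun i _ => continuous_finsetSum _ fun j _ => ?_
    exact (continuous_subtype_val.matrix_elem i j).abs
  obtain ⟨X, hX⟩ := h.compact.bddAbove_image hc.continuousOn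
  obtain ⟨Y, hY⟩ := h.compact.bddAbove_image (hc.comp continuous_inv).continuousOn
  refine ⟨max 1 (max X Y), by positivity, fun n hn => ⟨?_, ?_⟩⟩
  · exact (hX ⟨n, hn, rfl⟩).trans ((le_max_left _ _).trans (le_max_right _ _))
  · exact (hY ⟨n, hn, rfl⟩).trans ((le_max_right _ _).trans (le_max_right _ _))

/-- Descending from the last index, each Siegel inequality loses a factor `√3/2 ≥ 1/2`, and there
are at most `m` of them. -/
lemma siegel_diag_lower {m : ℕ} {a : Fin (m + 1) → ℝ} (ha : ∀ j, 0 < a j)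
    (hr : ∀ j : Fin m, Real.sqrt 3 / 2 * a j.succ ≤ a j.castSucc) (j : Fin (m + 1)) :
    (1 / 2 : ℝ) ^ m * a (Fin.last m) ≤ a j := by
  have h3 : (1 : ℝ) / 2 ≤ Real.sqrt 3 / 2 := by
    have : (1 : ℝ) ≤ Real.sqrt 3 := Real.one_le_sqrt.2 (by norm_num)
    linarith
  have key : ∀ j : Fin (m + 1), (1 / 2 : ℝ) ^ (m - j.1) * a (Fin.last m) ≤ a j := by
    intro j
    induction j using Fin.reverseInduction with
    | last => simp
    | cast i ih =>
      have e : m - (i.castSucc : Fin (m + 1)).1 = (m - i.succ.1) + 1 := by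
        have := i.2
        simp only [Fin.val_castSucc, Fin.val_succ]; omega
      rw [e, pow_succ]
      calc (1 / 2 : ℝ) ^ (m - i.succ.1) * (1 / 2) * a (Fin.last m)
          = 1 / 2 * ((1 / 2 : ℝ) ^ (m - i.succ.1) * a (Fin.last m)) := by ring
        _ ≤ 1 / 2 * a i.succ := by gcongr
        _ ≤ Real.sqrt 3 / 2 * a i.succ := mul_le_mul_of_nonneg_right h3 (ha _).le
        _ ≤ _ := hr i
  refine le_trans (mul_le_mul_of_nonneg_right ?_ (ha _).le) (key j)
  exact pow_le_pow_of_le_one (by norm_num) (by norm_num) (Nat.sub_le _ _)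

lemma le_pow_inv_of_prod_eq_one {m : ℕ} {a : Fin (m + 1) → ℝ} {s : ℝ} (hs : 0 < s)
    (ha : ∀ j, s ≤ a j) (hp : ∏ j, a j = 1) (j : Fin (m + 1)) : a j ≤ (s⁻¹) ^ m := by
  rw [Fin.prod_univ_succAbove _ j] at hp
  have h : s ^ m ≤ ∏ i : Fin m, a (j.succAbove i) := by
    calc s ^ m = ∏ _i : Fin m, s := by simp
      _ ≤ _ := Finset.prod_le_prod (fun _ _ => hs.le) fun i _ => ha _
  have h1 : a j * s ^ m ≤ 1 := by
    rw [← hp]; exact mul_le_mul_of_nonneg_left h (hs.le.trans (ha j))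
  rw [inv_pow]
  rwa [le_inv_comm₀ (hs.trans_le (ha j)) (pow_pos hs m), ← one_div,
    le_div_iff₀ (hs.trans_le (ha j)), mul_comm]

/-- Since `n` is upper unipotent, the last row of `n a k` is `a_d` times a row of an orthogonal
matrix, so a large entry there forces `a_d ≥ s`. The Siegel inequalities then bound all `a_j` below,
and determinant one bounds them above. This turns a statement about one row into bounds on the whole
matrix and its inverse. -/
theorem siegelSet_entrySum_le {m : ℕ} {FN : Set (G m)} (hFN : IsCompactRegion FN) :
    ∃ C : ℝ, 0 < C ∧ ∀ g ∈ siegelSet FN, ∀ s : ℝ, 0 < s → (∃ j, s ≤ |g (Fin.last m) j|) →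
      entrySum g.1 ≤ C * (s⁻¹) ^ m ∧ entrySum (g⁻¹).1 ≤ C * s⁻¹ := by
  obtain ⟨X, hX0, hX⟩ := hFN.exists_bound
  set D : ℝ := (m : ℝ) + 1 with hD
  have hD0 : 0 < D := by positivity
  have hcard : (Fintype.card (Fin (m + 1)) : ℝ) = D := by simp [hD]
  set C : ℝ := X * (D * ((2 : ℝ) ^ m) ^ m) * D ^ 2 + X * (D * 2 ^ m) * D ^ 2 with hC
  refine ⟨C, by positivity, ?_⟩
  rintro g ⟨n, hn, a, k, hk, ha, hp, hr, hg⟩ s hs ⟨j, hj⟩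
  have hk1 := abs_entry_le_one_of_orthogonal hk
  have hlast : g (Fin.last m) j = a (Fin.last m) * k (Fin.last m) j := by
    have hu := hFN.subset hn
    have e : (g : Matrix (Fin (m + 1)) (Fin (m + 1)) ℝ) (Fin.last m) j = _ :=
      congrFun (congrFun hg (Fin.last m)) j
    rw [Matrix.mul_apply, Finset.sum_eq_single (Fin.last m)] at e
    · rw [Matrix.mul_diagonal] at e
      have h1 : n.1 (Fin.last m) (Fin.last m) = 1 := hu.1 _
      rw [h1, one_mul] at e
      exact e
    · intro i _ hi
      have h0 : n.1 (Fin.last m) i = 0 := hu.2 _ _ (Fin.lt_last_iff_ne_last.2 hi)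
      rw [Matrix.mul_diagonal, h0]; ring
    · simp
  have hsl : s ≤ a (Fin.last m) := by
    rw [hlast, abs_mul, abs_of_pos (ha _)] at hj
    exact hj.trans (mul_le_of_le_one_right (ha _).le (hk1 _ _))
  set s' : ℝ := (1 / 2 : ℝ) ^ m * s with hs'
  have hs'0 : 0 < s' := by positivity
  have hlow : ∀ i, s' ≤ a i := fun i =>
    (mul_le_mul_of_nonneg_left hsl (by positivity)).trans (siegel_diag_lower ha hr i)
  have hup := le_pow_inv_of_prod_eq_one hs'0 hlow hp
  have hs'i : s'⁻¹ = 2 ^ m * s⁻¹ := by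
    rw [hs', mul_inv, ← inv_pow]; norm_num
  have hkk : entrySum k ≤ D ^ 2 := by
    have := entrySum_le_of_abs_le hk1
    rwa [hcard, mul_one] at this
  have hka : k * k.transpose = 1 := by
    have := (Matrix.mem_specialOrthogonalGroup_iff.1 hk).1
    exact (Matrix.mem_orthogonalGroup_iff _ _).1 this
  constructor
  · have hda : entrySum (Matrix.diagonal a) ≤ D * ((2 ^ m) ^ m * (s⁻¹) ^ m) := by
      rw [entrySum_diagonal]
      calc ∑ i, |a i| ≤ ∑ _i : Fin (m + 1), (s'⁻¹) ^ m :=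
            Finset.sum_le_sum fun i _ => by rw [abs_of_pos (ha i)]; exact hup i
        _ = _ := by rw [hs'i, mul_pow]; simp [hD]
    calc entrySum g.1 ≤ X * (D * ((2 ^ m) ^ m * (s⁻¹) ^ m)) * D ^ 2 := by
          rw [hg]
          refine (entrySum_mul_le _ _).trans ?_
          refine mul_le_mul ((entrySum_mul_le _ _).trans ?_) hkk (entrySum_nonneg _) (by positivity)
          exact mul_le_mul (hX n hn).1 hda (entrySum_nonneg _) hX0.le
      _ = X * (D * ((2 : ℝ) ^ m) ^ m) * D ^ 2 * (s⁻¹) ^ m := by ring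
      _ ≤ _ := by
          refine mul_le_mul_of_nonneg_right ?_ (by positivity)
          rw [hC]; exact le_add_of_nonneg_right (by positivity)
  -- The inverse involves only the `a_i⁻¹`, so the lower bound on `a` suffices and `s⁻¹` enters to
  -- the first power.
  · have hinv : (g⁻¹).1 = k.transpose * Matrix.diagonal (fun i => (a i)⁻¹) * (n⁻¹).1 := by
      have h1 : g.1 * (k.transpose * Matrix.diagonal (fun i => (a i)⁻¹) * (n⁻¹).1) = 1 := by
        have hd : Matrix.diagonal a * Matrix.diagonal (fun i => (a i)⁻¹) = 1 := by
          rw [Matrix.diagonal_mul_diagonal, ← Matrix.diagonal_one]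
          congr 1; funext i; exact mul_inv_cancel₀ (ha i).ne'
        have hnn : n.1 * (n⁻¹).1 = 1 := by
          rw [← Matrix.SpecialLinearGroup.coe_mul, mul_inv_cancel, Matrix.SpecialLinearGroup.coe_one]
        calc g.1 * (k.transpose * Matrix.diagonal (fun i => (a i)⁻¹) * (n⁻¹).1)
            = n.1 * (Matrix.diagonal a * (k * k.transpose) *
                Matrix.diagonal (fun i => (a i)⁻¹)) * (n⁻¹).1 := by
              rw [hg]; simp only [Matrix.mul_assoc]
          _ = 1 := by rw [hka, Matrix.mul_one, hd, Matrix.mul_one, hnn]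
      have h2 : (g⁻¹).1 * g.1 = 1 := by
        rw [← Matrix.SpecialLinearGroup.coe_mul, inv_mul_cancel, Matrix.SpecialLinearGroup.coe_one]
      exact left_inv_eq_right_inv h2 h1
    have hda : entrySum (Matrix.diagonal fun i => (a i)⁻¹) ≤ D * (2 ^ m * s⁻¹) := by
      rw [entrySum_diagonal]
      calc ∑ i, |(a i)⁻¹| ≤ ∑ _i : Fin (m + 1), s'⁻¹ :=
            Finset.sum_le_sum fun i _ => by
              rw [abs_of_pos (inv_pos.2 (ha i))]; exact inv_anti₀ hs'0 (hlow i)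
        _ = _ := by rw [hs'i]; simp [hD]
    calc entrySum (g⁻¹).1 ≤ D ^ 2 * (D * (2 ^ m * s⁻¹)) * X := by
          rw [hinv]
          refine (entrySum_mul_le _ _).trans ?_
          refine mul_le_mul ((entrySum_mul_le _ _).trans ?_) (hX n hn).2 (entrySum_nonneg _)
            (by positivity)
          rw [entrySum_transpose]
          exact mul_le_mul hkk hda (entrySum_nonneg _) (by positivity)
      _ = X * (D * (2 : ℝ) ^ m) * D ^ 2 * s⁻¹ := by ring
      _ ≤ _ := by
          refine mul_le_mul_of_nonneg_right ?_ (by positivity)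
          rw [hC]; exact le_add_of_nonneg_left (by positivity)

/-! ### The diagonal flow -/

lemma E_zero (m : ℕ) : E m 0 = 1 := by
  ext i j; simp [E]

lemma E_add (m : ℕ) (s t : ℝ) : E m (s + t) = E m s * E m t := by
  apply Subtype.ext
  rw [Matrix.SpecialLinearGroup.coe_mul]
  simp only [E, Matrix.diagonal_mul_diagonal]
  congr 1; funext i; rw [← Real.exp_add]; ring_nf

lemma E_neg (m : ℕ) (t : ℝ) : E m (-t) = (E m t)⁻¹ := by
  rw [eq_inv_iff_mul_eq_one, ← E_add, neg_add_cancel, E_zero]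

lemma rate_castSucc {m : ℕ} (i : Fin m) : rate m i.castSucc = -1 := by simp [rate]

lemma rate_last (m : ℕ) : rate m (Fin.last m) = m := by simp [rate]

lemma entrySum_E (m : ℕ) (t : ℝ) :
    entrySum (E m t).1 = m * Real.exp (-t) + Real.exp (m * t) := by
  simp only [E]
  rw [entrySum_diagonal, Fin.sum_univ_castSucc]
  simp [rate_castSucc, rate_last]

lemma entrySum_E_le (m : ℕ) {t : ℝ} (ht : 0 ≤ t) :
    entrySum (E m t).1 ≤ (m + 1) * Real.exp (m * t) := by
  rw [entrySum_E]
  have : Real.exp (-t) ≤ Real.exp (m * t) := Real.exp_le_exp.2 (by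
    have : 0 ≤ (m : ℝ) * t := by positivity
    linarith)
  nlinarith [(Nat.cast_nonneg m : (0 : ℝ) ≤ m)]

lemma entrySum_E_neg_le (m : ℕ) {t : ℝ} (ht : 0 ≤ t) :
    entrySum (E m (-t)).1 ≤ (m + 1) * Real.exp t := by
  rw [entrySum_E, neg_neg]
  have : Real.exp (m * -t) ≤ Real.exp t := Real.exp_le_exp.2 (by
    have : 0 ≤ (m : ℝ) * t := by positivity
    linarith)
  nlinarith

lemma exp_le_entrySum_E_neg {m : ℕ} (hm : 1 ≤ m) (t : ℝ) :
    Real.exp t ≤ entrySum (E m (-t)).1 := by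
  rw [entrySum_E, neg_neg]
  have h1 : (1 : ℝ) ≤ m := by exact_mod_cast hm
  nlinarith [Real.exp_pos t, Real.exp_pos ((m : ℝ) * -t)]

/-! ### The orbit of a Diophantine matrix -/

lemma paramMatrix_castSucc_last {m : ℕ} (α : Fin m → ℝ) (A : Matrix (Fin m) (Fin m) ℝ)
    (β : Fin m → ℝ) (γ : ℝ) (i : Fin m) :
    paramMatrix α A β γ i.castSucc (Fin.last m) = γ * α i := by
  have h1 : finSumFinEquiv.symm (i.castSucc : Fin (m + 1)) = Sum.inl i := by
    rw [Equiv.symm_apply_eq]; rfl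
  have h2 : finSumFinEquiv.symm (Fin.last m) = Sum.inr (0 : Fin 1) := by
    rw [Equiv.symm_apply_eq]; rfl
  simp [paramMatrix, h1, h2, Matrix.fromBlocks_multiply, mul_comm]

lemma paramMatrix_last_last {m : ℕ} (α : Fin m → ℝ) (A : Matrix (Fin m) (Fin m) ℝ)
    (β : Fin m → ℝ) (γ : ℝ) :
    paramMatrix α A β γ (Fin.last m) (Fin.last m) = γ := by
  have h2 : finSumFinEquiv.symm (Fin.last m) = Sum.inr (0 : Fin 1) := by
    rw [Equiv.symm_apply_eq]; rfl
  simp [paramMatrix, h2, Matrix.fromBlocks_multiply]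

/-- The last row of an integer unimodular matrix is not zero. -/
lemma last_row_ne_zero {m : ℕ} (P : Gam m) : ∃ i, P (Fin.last m) i ≠ 0 := by
  by_contra h
  push Not at h
  have := Matrix.det_eq_zero_of_row_eq_zero (A := P.1) (Fin.last m) h
  rw [P.2] at this
  exact one_ne_zero this

/-- The vector `k` in terms of the row vector `r = k M E^t`. -/
lemma abs_row_le_of_orbit {m : ℕ} (M : G m) (P : Gam m) {t ρ : ℝ} (ht : 0 ≤ t)
    (hρ : ∀ j, |(incl P * M * E m t) (Fin.last m) j| ≤ ρ) (i : Fin (m + 1)) :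
    |(P (Fin.last m) i : ℝ)| ≤
      ((m : ℝ) + 1) ^ 2 * entrySum (M⁻¹).1 * Real.exp t * ρ := by
  set g : G m := incl P * M * E m t with hg
  have hρ0 : 0 ≤ ρ := (abs_nonneg _).trans (hρ 0)
  -- Undoing the flow costs at most a factor of order `e^t`, the largest rate of `E^{-t}`.
  have e : incl P = g * (E m (-t) * M⁻¹) := by rw [hg, E_neg]; group
  have e1 : (P (Fin.last m) i : ℝ) = (g * (E m (-t) * M⁻¹)) (Fin.last m) i := by
    rw [← e]; rfl
  rw [e1]
  calc |(g * (E m (-t) * M⁻¹)) (Fin.last m) i|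
      ≤ ∑ j, |g (Fin.last m) j| * |(E m (-t) * M⁻¹).1 j i| := by
        have : (g * (E m (-t) * M⁻¹)) (Fin.last m) i =
            ∑ j, g (Fin.last m) j * (E m (-t) * M⁻¹).1 j i := by
          rw [Matrix.SpecialLinearGroup.coe_mul g]; rfl
        rw [this]
        exact (Finset.abs_sum_le_sum_abs _ _).trans_eq (by simp only [abs_mul])
    _ ≤ ∑ _j : Fin (m + 1), ρ * (((m : ℝ) + 1) * Real.exp t * entrySum (M⁻¹).1) := by
        refine Finset.sum_le_sum fun j _ => mul_le_mul (hρ j) ?_ (abs_nonneg _) hρ0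
        refine (abs_le_entrySum _ _ _).trans ?_
        rw [Matrix.SpecialLinearGroup.coe_mul]
        exact (entrySum_mul_le _ _).trans
          (mul_le_mul_of_nonneg_right (entrySum_E_neg_le m ht) (entrySum_nonneg _))
    _ = _ := by simp; ring

/-- The last entry of the row vector `k M E^t`. -/
lemma last_entry_orbit {m : ℕ} {M : G m} {α : Fin m → ℝ} {γ : ℝ}
    (hα : ∀ i : Fin m, M i.castSucc (Fin.last m) = γ * α i)
    (hγ : M (Fin.last m) (Fin.last m) = γ) (P : Gam m) (t : ℝ) :
    (incl P * M * E m t) (Fin.last m) (Fin.last m) =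
      γ * Real.exp (m * t) * (∑ i : Fin m, (P (Fin.last m) i.castSucc : ℝ) * α i +
        (P (Fin.last m) (Fin.last m) : ℝ)) := by
  have h1 : (incl P * M * E m t) (Fin.last m) (Fin.last m) =
      ((incl P).1 * M.1 * Matrix.diagonal fun i => Real.exp (rate m i * t))
        (Fin.last m) (Fin.last m) := rfl
  rw [h1, Matrix.mul_diagonal, rate_last, Matrix.mul_apply, Fin.sum_univ_castSucc]
  have h2 : ∀ i, (incl P).1 (Fin.last m) i = (P (Fin.last m) i : ℝ) := fun _ => rfl
  have h3 : ∀ i : Fin m, M.1 i.castSucc (Fin.last m) = γ * α i := hα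
  have h4 : M.1 (Fin.last m) (Fin.last m) = γ := hγ
  simp only [h2, h3, h4]
  have h5 : ∑ x : Fin m, (P (Fin.last m) x.castSucc : ℝ) * (γ * α x) =
      γ * ∑ x : Fin m, (P (Fin.last m) x.castSucc : ℝ) * α x := by
    rw [Finset.mul_sum]; exact Finset.sum_congr rfl fun x _ => by ring
  rw [h5]; ring

/-- A Diophantine vector: the linear form at a nonzero integer vector of size at most `X`. -/
lemma IsDiophantine.lower {m : ℕ} {α : Fin m → ℝ} {ε : ℝ} (hε : 0 < ε) (h : IsDiophantine α ε) :
    ∃ C : ℝ, 0 < C ∧ ∀ k : Fin (m + 1) → ℤ, (∃ i, k i ≠ 0) → ∀ X : ℝ, 0 ≤ X →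
      (∀ i, |(k i : ℝ)| ≤ X) →
      C ≤ (max 1 X) ^ ((m : ℝ) * (1 + ε)) *
        |∑ i : Fin m, (k i.castSucc : ℝ) * α i + (k (Fin.last m) : ℝ)| := by
  obtain ⟨C, hC, hd⟩ := h
  have hτ : 0 ≤ (m : ℝ) * (1 + ε) := by positivity
  refine ⟨min C 1, by positivity, fun k hk X hX hkX => ?_⟩
  -- The Diophantine condition is silent when the first `m` coordinates vanish; the form is then a
  -- nonzero integer, and `max 1 X` keeps the power at least one.
  by_cases hp : (fun i : Fin m => k i.castSucc) = 0
  · have h0 : ∀ i : Fin m, k i.castSucc = 0 := fun i => congrFun hp i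
    have hl : k (Fin.last m) ≠ 0 := by
      obtain ⟨i, hi⟩ := hk
      intro hl
      induction i using Fin.lastCases with
      | last => exact hi hl
      | cast i => exact hi (h0 i)
    have h1 : (1 : ℝ) ≤ |(k (Fin.last m) : ℝ)| := by
      exact_mod_cast Int.one_le_abs hl
    simp only [h0, Int.cast_zero, zero_mul, Finset.sum_const_zero, zero_add]
    refine (min_le_right _ _).trans (one_le_mul_of_one_le_of_one_le ?_ h1)
    exact Real.one_le_rpow (le_max_left _ _) hτ
  · refine (min_le_left _ _).trans ((hd _ hp (k (Fin.last m))).le.trans ?_)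
    refine mul_le_mul_of_nonneg_right ?_ (abs_nonneg _)
    refine Real.rpow_le_rpow (norm_nonneg _) ?_ hτ
    refine le_trans ?_ (le_max_right _ _)
    rw [pi_norm_le_iff_of_nonneg hX]
    exact fun i => hkX _

/-- Rows of `P M E^t` are not too short when the last column of `M` is Diophantine. -/
lemma exists_lower_last_row {m : ℕ} {ε : ℝ} (hε : 0 < ε) {α : Fin m → ℝ}
    (h : IsDiophantine α ε) {M : G m} {γ : ℝ} (hγ0 : 0 < γ)
    (hα : ∀ i : Fin m, M i.castSucc (Fin.last m) = γ * α i)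
    (hγ : M (Fin.last m) (Fin.last m) = γ) {θ : ℝ} (hθ : θ < 1)
    (hτ : (m : ℝ) * (1 + ε) * (1 - θ) = m + θ) :
    ∃ c : ℝ, 0 < c ∧ ∀ (P : Gam m) (t : ℝ), 0 ≤ t →
      ∃ j, c * Real.exp (-θ * t) ≤ |(incl P * M * E m t) (Fin.last m) j| := by
  obtain ⟨C, hC, hd⟩ := h.lower hε
  set W : ℝ := ((m : ℝ) + 1) ^ 2 * entrySum (M⁻¹).1 with hW
  have hW0 : 0 ≤ W := mul_nonneg (by positivity) (entrySum_nonneg _)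
  -- The first bound makes the integer row at most `e^{(1-θ)t}`; the second contradicts `C γ ≤ c`,
  -- the conclusion drawn from a short row.
  set c : ℝ := min (1 / (1 + W)) (C * γ / 2) with hc
  have hc0 : 0 < c := by positivity
  refine ⟨c, hc0, fun P t ht => ?_⟩
  by_contra hcon
  push Not at hcon
  have hk := abs_row_le_of_orbit M P ht (fun j => (hcon j).le)
  have hX0 : 0 ≤ W * Real.exp t * (c * Real.exp (-θ * t)) := by positivity
  have h1 := hd (fun i => P (Fin.last m) i) (last_row_ne_zero P) _ hX0 hk
  have hlast := hcon (Fin.last m)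
  rw [last_entry_orbit hα hγ, abs_mul, abs_of_pos (by positivity)] at hlast
  set L := |∑ i : Fin m, (P (Fin.last m) i.castSucc : ℝ) * α i +
        (P (Fin.last m) (Fin.last m) : ℝ)| with hL
  have hXle : max 1 (W * Real.exp t * (c * Real.exp (-θ * t))) ≤ Real.exp ((1 - θ) * t) := by
    refine max_le (Real.one_le_exp (by nlinarith)) ?_
    have e : Real.exp t * Real.exp (-θ * t) = Real.exp ((1 - θ) * t) := by
      rw [← Real.exp_add]; ring_nf
    have hWc : W * c ≤ 1 := by
      calc W * c ≤ W * (1 / (1 + W)) := mul_le_mul_of_nonneg_left (min_le_left _ _) hW0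
        _ ≤ 1 := by rw [mul_one_div, div_le_one (by positivity)]; linarith
    calc W * Real.exp t * (c * Real.exp (-θ * t)) = W * c * Real.exp ((1 - θ) * t) := by
          rw [← e]; ring
      _ ≤ _ := mul_le_of_le_one_left (Real.exp_pos _).le hWc
  have h2 : (max 1 (W * Real.exp t * (c * Real.exp (-θ * t)))) ^ ((m : ℝ) * (1 + ε)) ≤
      Real.exp ((m + θ) * t) := by
    refine (Real.rpow_le_rpow (by positivity) hXle (by positivity)).trans_eq ?_
    rw [← Real.exp_mul, ← hτ]; ring_nf
  have h3 : C ≤ Real.exp ((m + θ) * t) * L :=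
    h1.trans (mul_le_mul_of_nonneg_right h2 (abs_nonneg _))
  have e3 : Real.exp ((m + θ) * t) * Real.exp (-θ * t) = Real.exp (m * t) := by
    rw [← Real.exp_add]; ring_nf
  have h4 : C * γ * Real.exp (m * t) ≤ c * Real.exp (m * t) := by
    calc C * γ * Real.exp (m * t) ≤ (Real.exp ((m + θ) * t) * L) * (γ * Real.exp (m * t)) := by
          rw [mul_assoc]; exact mul_le_mul_of_nonneg_right h3 (by positivity)
      _ = Real.exp ((m + θ) * t) * (γ * Real.exp (m * t) * L) := by ring
      _ ≤ Real.exp ((m + θ) * t) * (c * Real.exp (-θ * t)) := by gcongr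
      _ = _ := by rw [← e3]; ring
  have h5 : C * γ ≤ c := le_of_mul_le_mul_right h4 (Real.exp_pos _)
  have h6 : c ≤ C * γ / 2 := min_le_right _ _
  have : 0 < C * γ := by positivity
  linarith

/-- Bounds along the orbit of a matrix whose last column is Diophantine. -/
theorem orbit_bounds {m : ℕ} {ε : ℝ} (hε : 0 < ε) {FN F : Set (G m)}
    (hFN : IsCompactRegion FN) (hF : IsFundDomain F) (hS : F ⊆ siegelSet FN) {α : Fin m → ℝ}
    (h : IsDiophantine α ε) {M : G m} {γ : ℝ} (hγ0 : 0 < γ)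
    (hα : ∀ i : Fin m, M i.castSucc (Fin.last m) = γ * α i)
    (hγ : M (Fin.last m) (Fin.last m) = γ) {θ : ℝ} (hθ0 : 0 ≤ θ) (hθ : θ < 1)
    (hτ : (m : ℝ) * (1 + ε) * (1 - θ) = m + θ) :
    ∃ C : ℝ, 1 ≤ C ∧ ∀ t : ℝ, 0 ≤ t →
      entrySum (incl (cfP F M t) * M * E m t).1 ≤ C * Real.exp (m * θ * t) ∧
      entrySum ((incl (cfP F M t) * M * E m t)⁻¹).1 ≤ C * Real.exp (θ * t) ∧
      1 ≤ C * Real.exp (m * (1 + ε) * (1 + m * θ) * t) *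
        |gam (incl (cfP F M t) * M * E m t)| := by
  obtain ⟨C₁, hC₁, hs⟩ := siegelSet_entrySum_le hFN
  obtain ⟨c, hc, hrow⟩ := exists_lower_last_row hε h hγ0 hα hγ hθ hτ
  obtain ⟨C₂, hC₂, hd⟩ := h.lower hε
  set A₁ : ℝ := C₁ * (c⁻¹) ^ m with hA₁
  set A₂ : ℝ := C₁ * c⁻¹ with hA₂
  set W : ℝ := ((m : ℝ) + 1) ^ 2 * entrySum (M⁻¹).1 with hW
  have hW0 : 0 ≤ W := mul_nonneg (by positivity) (entrySum_nonneg _)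
  have hA₁0 : 0 < A₁ := by positivity
  set A₃ : ℝ := (1 + W * A₁) ^ ((m : ℝ) * (1 + ε)) / (C₂ * γ) with hA₃
  refine ⟨max 1 (max A₁ (max A₂ A₃)), le_max_left _ _, fun t ht => ?_⟩
  set g : G m := incl (cfP F M t) * M * E m t with hg
  obtain ⟨h1, h2⟩ := hs g (hS (cfP_mem hF M t)) _ (by positivity : 0 < c * Real.exp (-θ * t))
    (hrow _ t ht)
  have hi : (c * Real.exp (-θ * t))⁻¹ = c⁻¹ * Real.exp (θ * t) := by
    rw [mul_inv, ← Real.exp_neg]; ring_nf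
  rw [hi] at h1 h2
  have h1' : entrySum g.1 ≤ A₁ * Real.exp (m * θ * t) := by
    refine h1.trans_eq ?_
    rw [mul_pow, ← Real.exp_nat_mul, hA₁]; ring_nf
  refine ⟨h1'.trans ?_, ?_, ?_⟩
  · refine mul_le_mul_of_nonneg_right ?_ (Real.exp_pos _).le
    exact (le_max_left _ _).trans (le_max_right _ _)
  · refine (h2.trans_eq (by rw [hA₂]; ring : _ = A₂ * Real.exp (θ * t))).trans ?_
    refine mul_le_mul_of_nonneg_right ?_ (Real.exp_pos _).le
    exact (le_max_left _ _).trans ((le_max_right _ _).trans (le_max_right _ _))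
  -- The upper bound just proved limits the integer row to `e^{(1+mθ)t}` up to a constant. The
  -- Diophantine condition at that size yields the exponent `m(1+ε)(1+mθ)`; the gain `e^{mt}` in
  -- `γ^{(n)}` is simply discarded.
  · have hk := abs_row_le_of_orbit M (cfP F M t) ht
      (fun j => (abs_le_entrySum g.1 (Fin.last m) j).trans h1')
    have hX0 : 0 ≤ W * Real.exp t * (A₁ * Real.exp (m * θ * t)) := by positivity
    have h3 := hd (fun i => cfP F M t (Fin.last m) i) (last_row_ne_zero _) _ hX0 hk
    have hgam : |gam g| = γ * Real.exp (m * t) *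
        |∑ i : Fin m, (cfP F M t (Fin.last m) i.castSucc : ℝ) * α i +
          (cfP F M t (Fin.last m) (Fin.last m) : ℝ)| := by
      rw [gam, hg, last_entry_orbit hα hγ, abs_mul, abs_of_pos (by positivity)]
    set L := |∑ i : Fin m, (cfP F M t (Fin.last m) i.castSucc : ℝ) * α i +
        (cfP F M t (Fin.last m) (Fin.last m) : ℝ)| with hL
    have hXle : max 1 (W * Real.exp t * (A₁ * Real.exp (m * θ * t))) ≤
        (1 + W * A₁) * Real.exp ((1 + m * θ) * t) := by
      have e : Real.exp ((1 + m * θ) * t) = Real.exp t * Real.exp (m * θ * t) := by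
        rw [← Real.exp_add]; ring_nf
      have hE : 1 ≤ Real.exp ((1 + m * θ) * t) := Real.one_le_exp (by positivity)
      refine max_le ?_ ?_
      · exact one_le_mul_of_one_le_of_one_le (by
          have : 0 ≤ W * A₁ := by positivity
          linarith) hE
      · rw [e]
        have : 0 < Real.exp t * Real.exp (m * θ * t) := by positivity
        nlinarith
    have h4 : (max 1 (W * Real.exp t * (A₁ * Real.exp (m * θ * t)))) ^ ((m : ℝ) * (1 + ε)) ≤
        (1 + W * A₁) ^ ((m : ℝ) * (1 + ε)) * Real.exp (m * (1 + ε) * (1 + m * θ) * t) := by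
      refine (Real.rpow_le_rpow (by positivity) hXle (by positivity)).trans_eq ?_
      rw [Real.mul_rpow (by positivity) (Real.exp_pos _).le, ← Real.exp_mul]; ring_nf
    have h5 : C₂ ≤ (1 + W * A₁) ^ ((m : ℝ) * (1 + ε)) *
        Real.exp (m * (1 + ε) * (1 + m * θ) * t) * L :=
      h3.trans (mul_le_mul_of_nonneg_right h4 (abs_nonneg _))
    have h6 : L ≤ |gam g| / γ := by
      rw [hgam, le_div_iff₀ hγ0]
      have : 1 ≤ Real.exp (m * t) := Real.one_le_exp (by positivity)
      have hL0 : 0 ≤ L := abs_nonneg _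
      have : L * γ * 1 ≤ L * γ * Real.exp (m * t) := by gcongr
      linarith
    have h7 : 1 ≤ A₃ * Real.exp (m * (1 + ε) * (1 + m * θ) * t) * |gam g| := by
      have h8 : C₂ ≤ (1 + W * A₁) ^ ((m : ℝ) * (1 + ε)) *
        Real.exp (m * (1 + ε) * (1 + m * θ) * t) * (|gam g| / γ) :=
        h5.trans (mul_le_mul_of_nonneg_left h6 (by positivity))
      calc 1 = C₂ / C₂ := (div_self hC₂.ne').symm
        _ ≤ _ / C₂ := div_le_div_of_nonneg_right h8 hC₂.le
        _ = _ := by rw [hA₃]; field_simp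
    refine h7.trans ?_
    gcongr
    exact (le_max_right _ _).trans ((le_max_right _ _).trans (le_max_right _ _))

/-! ### Comparison of norms -/

/-- The norm `N` and the maximum norm differ by a factor at most `K`. -/
def NormEquiv {m : ℕ} (N : Seminorm ℝ (Fin (m + 1) → ℝ)) (K : ℝ) : Prop :=
  1 ≤ K ∧ (∀ x, N x ≤ K * ‖x‖) ∧ ∀ x, ‖x‖ ≤ K * N x

lemma exists_normEquiv {m : ℕ} (N : Seminorm ℝ (Fin (m + 1) → ℝ)) (hN : ∀ x, N x = 0 → x = 0) :
    ∃ K, NormEquiv N K := by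
  set K₁ : ℝ := ∑ i, N (Pi.single i 1) with hK₁
  have hK₁0 : 0 ≤ K₁ := Finset.sum_nonneg fun _ _ => apply_nonneg _ _
  have hup : ∀ x, N x ≤ K₁ * ‖x‖ := by
    intro x
    have hx : x = ∑ i, x i • (Pi.single i 1 : Fin (m + 1) → ℝ) := by
      ext j; simp [Finset.sum_apply, Pi.single_apply]
    calc N x = N (∑ i, x i • (Pi.single i 1 : Fin (m + 1) → ℝ)) := by rw [← hx]
      _ ≤ ∑ i, N (x i • (Pi.single i 1 : Fin (m + 1) → ℝ)) := 
          Finset.le_sum_of_subadditive N (map_zero N).le (map_add_le_add N) _ _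
      _ ≤ ∑ i, N (Pi.single i 1) * ‖x‖ := by
          refine Finset.sum_le_sum fun i _ => ?_
          rw [map_smul_eq_mul, mul_comm]
          exact mul_le_mul_of_nonneg_left (norm_le_pi_norm x i) (apply_nonneg _ _)
      _ = _ := by rw [Finset.sum_mul]
  have hcont : Continuous N := by
    refine Seminorm.continuous_of_le
      (q := K₁.toNNReal • normSeminorm ℝ (Fin (m + 1) → ℝ)) ?_ fun x => ?_
    · exact continuous_const.mul continuous_norm
    · refine (hup x).trans_eq ?_
      rw [smul_apply, NNReal.smul_def, Real.coe_toNNReal _ hK₁0]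
      rfl
  obtain ⟨x₀, hx₀, hmin⟩ := (isCompact_sphere (0 : Fin (m + 1) → ℝ) 1).exists_isMinOn
    (NormedSpace.sphere_nonempty.2 zero_le_one) hcont.continuousOn
  have hx₀n : ‖x₀‖ = 1 := by simpa using hx₀
  have hpos : 0 < N x₀ := by
    refine lt_of_le_of_ne (apply_nonneg _ _) fun h => ?_
    rw [hN x₀ h.symm, norm_zero] at hx₀n
    exact zero_ne_one hx₀n
  refine ⟨max 1 (max K₁ (N x₀)⁻¹), le_max_left _ _, fun x => (hup x).trans ?_, fun x => ?_⟩
  · exact mul_le_mul_of_nonneg_right ((le_max_left _ _).trans (le_max_right _ _)) (norm_nonneg _)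
  · rcases eq_or_ne x 0 with rfl | hx
    · simp
    · have hxn : 0 < ‖x‖ := norm_pos_iff.2 hx
      have h1 : N x₀ ≤ N (‖x‖⁻¹ • x) := hmin (by
        simp [norm_smul, hxn.ne'])
      rw [map_smul_eq_mul, norm_inv, norm_norm, inv_mul_eq_div, le_div_iff₀ hxn] at h1
      have h2 : ‖x‖ ≤ (N x₀)⁻¹ * N x := by
        rw [inv_mul_eq_div, le_div_iff₀ hpos]; linarith
      refine h2.trans (mul_le_mul_of_nonneg_right ?_ (apply_nonneg _ _))
      exact (le_max_right _ _).trans (le_max_right _ _)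

section

variable {m : ℕ} {N : Seminorm ℝ (Fin (m + 1) → ℝ)} {K : ℝ}

lemma NormEquiv.pos (h : NormEquiv N K) {x : Fin (m + 1) → ℝ} (hx : x ≠ 0) : 0 < N x := by
  have h1 := h.2.2 x
  have h2 : 0 < ‖x‖ := norm_pos_iff.2 hx
  have h3 := h.1
  by_contra hc
  have : N x = 0 := le_antisymm (not_lt.1 hc) (apply_nonneg _ _)
  rw [this] at h1
  linarith

lemma NormEquiv.mulVec_le (h : NormEquiv N K) (B : Matrix (Fin (m + 1)) (Fin (m + 1)) ℝ)
    (x : Fin (m + 1) → ℝ) : N (B.mulVec x) ≤ K ^ 2 * entrySum B * N x := by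
  have hK : 0 ≤ K := zero_le_one.trans h.1
  calc N (B.mulVec x) ≤ K * (entrySum B * (K * N x)) := by
        refine (h.2.1 _).trans (mul_le_mul_of_nonneg_left ?_ hK)
        exact (norm_mulVec_le B x).trans
          (mul_le_mul_of_nonneg_left (h.2.2 x) (entrySum_nonneg _))
    _ = _ := by ring

lemma NormEquiv.div_le (h : NormEquiv N K) (B : Matrix (Fin (m + 1)) (Fin (m + 1)) ℝ)
    {x : Fin (m + 1) → ℝ} (hx : x ≠ 0) : N (B.mulVec x) / N x ≤ K ^ 2 * entrySum B := by
  rw [div_le_iff₀ (h.pos hx)]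
  exact h.mulVec_le B x

lemma opNorm_nonneg (N : Seminorm ℝ (Fin (m + 1) → ℝ))
    (B : Matrix (Fin (m + 1)) (Fin (m + 1)) ℝ) : 0 ≤ opNorm N B := by
  refine Real.sSup_nonneg ?_
  rintro r ⟨x, _, rfl⟩
  exact div_nonneg (apply_nonneg _ _) (apply_nonneg _ _)

lemma NormEquiv.opNorm_le (h : NormEquiv N K) (B : Matrix (Fin (m + 1)) (Fin (m + 1)) ℝ) :
    opNorm N B ≤ K ^ 2 * entrySum B := by
  refine Real.sSup_le ?_ (mul_nonneg (sq_nonneg _) (entrySum_nonneg _))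
  rintro r ⟨x, hx, rfl⟩
  exact h.div_le B hx

lemma NormEquiv.abs_le_opNorm (h : NormEquiv N K) (B : Matrix (Fin (m + 1)) (Fin (m + 1)) ℝ)
    (i j : Fin (m + 1)) : |B i j| ≤ K ^ 2 * opNorm N B := by
  have hK : 0 ≤ K := zero_le_one.trans h.1
  set e : Fin (m + 1) → ℝ := Pi.single j 1 with he
  have hne : e ≠ 0 := fun h0 => by
    have := congrFun h0 j
    simp [he] at this
  have hn : ‖e‖ ≤ 1 := by
    rw [pi_norm_le_iff_of_nonneg zero_le_one]
    intro i
    by_cases hi : i = j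
    · subst hi; simp [he]
    · simp [he, hi]
  have h1 : N (B.mulVec e) / N e ≤ opNorm N B := by
    refine le_csSup ⟨K ^ 2 * entrySum B, ?_⟩ ⟨e, hne, rfl⟩
    rintro r ⟨x, hx, rfl⟩
    exact h.div_le B hx
  rw [div_le_iff₀ (h.pos hne)] at h1
  have h2 : B.mulVec e i = B i j := by simp [he]
  calc |B i j| = ‖B.mulVec e i‖ := by rw [h2, Real.norm_eq_abs]
    _ ≤ K * (opNorm N B * N e) :=
        (norm_le_pi_norm _ i).trans ((h.2.2 _).trans (mul_le_mul_of_nonneg_left h1 hK))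
    _ ≤ K * (opNorm N B * (K * 1)) := by
        refine mul_le_mul_of_nonneg_left (mul_le_mul_of_nonneg_left ?_ (opNorm_nonneg N B)) hK
        exact (h.2.1 e).trans (mul_le_mul_of_nonneg_left hn hK)
    _ = _ := by ring

lemma NormEquiv.opNorm_pos (h : NormEquiv N K) (g : G m) : 0 < opNorm N g.1 := by
  by_contra hc
  have h0 : opNorm N g.1 = 0 := le_antisymm (not_lt.1 hc) (opNorm_nonneg _ _)
  have hz : ∀ j, g.1 0 j = 0 := fun j => by
    have := h.abs_le_opNorm g.1 0 j
    rw [h0, mul_zero] at this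
    exact abs_nonpos_iff.1 this
  have := Matrix.det_eq_zero_of_row_eq_zero 0 hz
  rw [g.2] at this
  exact one_ne_zero this

end

/-! ### One step of the renormalization scheme -/

/-- Exponential bounds for the matrices `P(s) M E^s`. -/
structure OrbitBound {m : ℕ} (F : Set (G m)) (M : G m) (C θ χ : ℝ) : Prop where
  one_le : 1 ≤ C
  le : ∀ s, 0 ≤ s → entrySum (incl (cfP F M s) * M * E m s).1 ≤ C * Real.exp (m * θ * s)
  inv_le : ∀ s, 0 ≤ s → entrySum ((incl (cfP F M s) * M * E m s)⁻¹).1 ≤ C * Real.exp (θ * s)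
  gam_lower : ∀ s, 0 ≤ s →
    1 ≤ C * Real.exp (χ * s) * |gam (incl (cfP F M s) * M * E m s)|

section Step

variable {m : ℕ} {N : Seminorm ℝ (Fin (m + 1) → ℝ)} {F : Set (G m)} {M : G m} {t σ : ℕ → ℝ}
  {K C θ χ : ℝ}

/-- The initial matrix cancels between consecutive renormalizations, leaving only the diagonal flow
over one time step. All bounds on `T^{(n)}` and its inverse come from this factorization. -/
lemma Tn_eq (F : Set (G m)) (M : G m) (t : ℕ → ℝ) (n : ℕ) :
    Tn F M t n = Mn F M t n * E m (-dt t n) * (Mn F M t (n - 1))⁻¹ := by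
  have h : E m (t n) = E m (t (n - 1)) * E m (dt t n) := by
    rw [← E_add]; congr 1; simp [dt]
  rw [E_neg, Tn, Mn, Mn, h, map_mul, map_inv]
  have h' : E m (t (n - 1)) * E m (dt t n) = E m (dt t n) * E m (t (n - 1)) := by
    rw [← E_add, ← E_add, add_comm]
  group

lemma Tn_inv_eq (F : Set (G m)) (M : G m) (t : ℕ → ℝ) (n : ℕ) :
    (Tn F M t n)⁻¹ = Mn F M t (n - 1) * E m (dt t n) * (Mn F M t n)⁻¹ := by
  rw [Tn_eq, E_neg]; group

lemma entrySum_coe_mul_le (g h : G m) : entrySum (g * h).1 ≤ entrySum g.1 * entrySum h.1 := by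
  rw [Matrix.SpecialLinearGroup.coe_mul]; exact entrySum_mul_le _ _

lemma OrbitBound.Mn_le (h : OrbitBound F M C θ χ) {n : ℕ} (hn : 0 ≤ t n) :
    entrySum (Mn F M t n).1 ≤ C * Real.exp (m * θ * t n) := h.le _ hn

lemma OrbitBound.Mn_inv_le (h : OrbitBound F M C θ χ) {n : ℕ} (hn : 0 ≤ t n) :
    entrySum ((Mn F M t n)⁻¹).1 ≤ C * Real.exp (θ * t n) := h.inv_le _ hn

lemma OrbitBound.gamn_lower (h : OrbitBound F M C θ χ) {n : ℕ} (hn : 0 ≤ t n) :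
    1 ≤ C * Real.exp (χ * t n) * |gamn F M t n| := h.gam_lower _ hn

lemma OrbitBound.gamn_ne_zero (h : OrbitBound F M C θ χ) {n : ℕ} (hn : 0 ≤ t n) :
    gamn F M t n ≠ 0 := fun h0 => by
  have := h.gamn_lower hn
  rw [h0, abs_zero, mul_zero] at this
  linarith

lemma OrbitBound.gamn_inv_le (h : OrbitBound F M C θ χ) {n : ℕ} (hn : 0 ≤ t n) :
    |gamn F M t n|⁻¹ ≤ C * Real.exp (χ * t n) := by
  rw [inv_le_iff_one_le_mul₀ (abs_pos.2 (h.gamn_ne_zero hn))]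
  exact h.gamn_lower hn

/-- The stopping times are distinguished by their matrices when the time step is long. -/
lemma OrbitBound.Pn_ne (h : OrbitBound F M C θ χ) (hm : 1 ≤ m) {n : ℕ} (hn : 0 ≤ t n)
    (hn' : 0 ≤ t (n - 1))
    (hlt : C ^ 2 < Real.exp (dt t n - θ * t n - m * θ * t (n - 1))) :
    Pn F M t n ≠ Pn F M t (n - 1) := by
  intro he
  have hC : 0 ≤ C := zero_le_one.trans h.one_le
  -- Equal matrices would make `E^{-δt_n}` a product of two slowly growing matrices, whereas it has
  -- an entry `e^{δt_n}`.
  have h1 : Tn F M t n = 1 := by rw [Tn, he, mul_inv_cancel, map_one]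
  have h2 : E m (-dt t n) = (Mn F M t n)⁻¹ * Mn F M t (n - 1) := by
    rw [Tn_eq] at h1
    calc E m (-dt t n) = (Mn F M t n)⁻¹ *
          (Mn F M t n * E m (-dt t n) * (Mn F M t (n - 1))⁻¹) * Mn F M t (n - 1) := by group
      _ = _ := by rw [h1]; group
  have h3 : Real.exp (dt t n) ≤ C * Real.exp (θ * t n) * (C * Real.exp (m * θ * t (n - 1))) := by
    refine (exp_le_entrySum_E_neg hm _).trans ?_
    rw [h2]
    exact (entrySum_coe_mul_le _ _).trans
      (mul_le_mul (h.Mn_inv_le hn) (h.Mn_le hn') (entrySum_nonneg _) (by positivity))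
  have e : Real.exp (dt t n) = Real.exp (dt t n - θ * t n - m * θ * t (n - 1)) *
      Real.exp (θ * t n) * Real.exp (m * θ * t (n - 1)) := by
    rw [← Real.exp_add, ← Real.exp_add]; ring_nf
  have h4 : Real.exp (dt t n - θ * t n - m * θ * t (n - 1)) *
      (Real.exp (θ * t n) * Real.exp (m * θ * t (n - 1))) ≤
      C ^ 2 * (Real.exp (θ * t n) * Real.exp (m * θ * t (n - 1))) := by
    rw [← mul_assoc, ← e]; refine h3.trans_eq (by ring)
  exact absurd (le_of_mul_le_mul_right h4 (by positivity)) (not_le.2 hlt)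

lemma An_nonneg (N : Seminorm ℝ (Fin (m + 1) → ℝ)) (F : Set (G m)) (M : G m) (t σ : ℕ → ℝ)
    (n : ℕ) : 0 ≤ An N F M t σ n := by
  refine Real.sSup_nonneg ?_
  rintro r ⟨k, _, _, rfl⟩
  exact div_nonneg (apply_nonneg _ _) (apply_nonneg _ _)

lemma Bn_nonneg (N : Seminorm ℝ (Fin (m + 1) → ℝ)) (F : Set (G m)) (M : G m) (t σ : ℕ → ℝ)
    (n : ℕ) : 0 ≤ Bn N F M t σ n :=
  Finset.prod_nonneg fun _ _ => An_nonneg _ _ _ _ _ _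

/-- Vectors in a thin resonant cone are contracted. -/
lemma OrbitBound.An_le (h : OrbitBound F M C θ χ) (hN : NormEquiv N K) {n : ℕ} (hn : 0 ≤ t n)
    (hn' : 0 ≤ t (n + 1))
    (hσ : Real.exp (m * dt t (n + 1)) * σ n ≤ Real.exp (-dt t (n + 1))) :
    An N F M t σ n ≤ 2 * K ^ 2 * C ^ 2 *
      Real.exp (-(dt t (n + 1) - θ * t (n + 1) - m * θ * t n)) := by
  have hC : 0 ≤ C := zero_le_one.trans h.one_le
  have hK : 0 ≤ K := zero_le_one.trans hN.1
  -- Nonnegativity of the bound also covers a cone without nonzero integer vectors, where the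
  -- supremum is `0`.
  refine Real.sSup_le ?_ (by positivity)
  rintro r ⟨k, hk, hk0, rfl⟩
  set x : Fin (m + 1) → ℝ := fun i => (k i : ℝ) with hx
  have hx0 : x ≠ 0 := fun h0 => hk0 (by
    funext i
    have := congrFun h0 i
    simpa [hx] using this)
  rw [div_le_iff₀ (hN.pos hx0)]
  set S := entrySum (Mn F M t n).1 with hS
  set v := (Mn F M t n).1.transpose.mulVec x with hv
  set w := (E m (dt t (n + 1))).1.mulVec v with hw
  have hT : ((Tn F M t (n + 1))⁻¹).1.transpose.mulVec x =
      ((Mn F M t (n + 1))⁻¹).1.transpose.mulVec w := by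
    have hE : (E m (dt t (n + 1))).1.transpose = (E m (dt t (n + 1))).1 := by
      simp [E]
    rw [Tn_inv_eq, Matrix.SpecialLinearGroup.coe_mul, Matrix.SpecialLinearGroup.coe_mul,
      Matrix.transpose_mul, Matrix.transpose_mul, hE, hw, hv, Matrix.mulVec_mulVec,
      Matrix.mulVec_mulVec, Matrix.mul_assoc]
    rfl
  have hv_norm : ‖v‖ ≤ S * ‖x‖ := by
    have := norm_mulVec_le (Mn F M t n).1.transpose x
    rwa [entrySum_transpose] at this
  have hγ0 : gamn F M t n ≠ 0 := h.gamn_ne_zero hn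
  have hv_last : |v (Fin.last m)| ≤ S * (σ n * N x) := by
    -- The coordinate expanded by the flow is exactly the linear form that defines the cone.
    have e : v (Fin.last m) = gamn F M t n * ∑ i, (k i : ℝ) * omn F M t n i := by
      have e0 : v (Fin.last m) = ∑ i, (Mn F M t n).1.transpose (Fin.last m) i * x i := rfl
      rw [e0, Finset.mul_sum]
      refine Finset.sum_congr rfl fun i _ => ?_
      simp only [omn, Pi.smul_apply, smul_eq_mul, Matrix.mulVec_single_one, Matrix.col_apply,
        Matrix.transpose_apply, hx]
      field_simp
    rw [e, abs_mul]
    exact mul_le_mul (abs_le_entrySum (Mn F M t n).1 _ _) hk (abs_nonneg _) (entrySum_nonneg _)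
  have hS0 : 0 ≤ S := entrySum_nonneg _
  have hNx : 0 ≤ N x := apply_nonneg _ _
  have hw_norm : ‖w‖ ≤ Real.exp (-dt t (n + 1)) * S * (2 * K * N x) := by
    have hxK : ‖x‖ ≤ 2 * K * N x := (hN.2.2 x).trans (by nlinarith [mul_nonneg hK hNx])
    have hNK : N x ≤ 2 * K * N x := by nlinarith [hN.1]
    rw [pi_norm_le_iff_of_nonneg (by positivity)]
    intro j
    have hwj : w j = Real.exp (rate m j * dt t (n + 1)) * v j := by
      rw [hw]; simp [E, Matrix.mulVec_diagonal]
    rw [hwj, Real.norm_eq_abs, abs_mul, abs_of_pos (Real.exp_pos _)]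
    induction j using Fin.lastCases with
    | cast i =>
      rw [rate_castSucc, neg_one_mul, mul_assoc]
      refine mul_le_mul_of_nonneg_left ?_ (Real.exp_pos _).le
      exact ((norm_le_pi_norm v _).trans hv_norm).trans (mul_le_mul_of_nonneg_left hxK hS0)
    -- The width `σ_n` pays for the expansion `e^{mδt}` and still leaves the contraction `e^{-δt}`
    -- of the other coordinates.
    | last =>
      rw [rate_last]
      calc Real.exp (m * dt t (n + 1)) * |v (Fin.last m)|
          ≤ Real.exp (m * dt t (n + 1)) * (S * (σ n * N x)) := by gcongr
        _ = Real.exp (m * dt t (n + 1)) * σ n * (S * N x) := by ring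
        _ ≤ Real.exp (-dt t (n + 1)) * (S * N x) := by gcongr
        _ ≤ Real.exp (-dt t (n + 1)) * (S * (2 * K * N x)) := by gcongr
        _ = _ := by ring
  rw [hT]
  calc N (((Mn F M t (n + 1))⁻¹).1.transpose.mulVec w)
      ≤ K * ((C * Real.exp (θ * t (n + 1))) *
        (Real.exp (-dt t (n + 1)) * (C * Real.exp (m * θ * t n)) * (2 * K * N x))) := by
        refine (hN.2.1 _).trans (mul_le_mul_of_nonneg_left ?_ hK)
        refine (norm_mulVec_le _ _).trans ?_
        rw [entrySum_transpose]
        refine mul_le_mul (h.Mn_inv_le hn') (hw_norm.trans ?_) (norm_nonneg _) (by positivity)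
        have := h.Mn_le hn
        gcongr
    _ = 2 * K ^ 2 * C ^ 2 * (Real.exp (θ * t (n + 1)) * Real.exp (-dt t (n + 1)) *
        Real.exp (m * θ * t n)) * N x := by ring
    _ = _ := by rw [← Real.exp_add, ← Real.exp_add]; ring_nf

/-! ### Widths -/

lemma NormEquiv.width_le (hN : NormEquiv N K) {n : ℕ} (hσ : 0 ≤ σ n) :
    width N F M t σ n ≤ σ n * K ^ 2 := by
  rw [width, div_le_iff₀ (hN.opNorm_pos _), mul_assoc]
  exact mul_le_mul_of_nonneg_left (hN.abs_le_opNorm _ _ _) hσ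

lemma OrbitBound.width_pos (h : OrbitBound F M C θ χ) (hN : NormEquiv N K) {n : ℕ}
    (hn : 0 ≤ t n) (hσ : 0 < σ n) : 0 < width N F M t σ n :=
  div_pos (mul_pos hσ (abs_pos.2 (h.gamn_ne_zero hn))) (hN.opNorm_pos _)

lemma OrbitBound.width_ge (h : OrbitBound F M C θ χ) (hN : NormEquiv N K) {n : ℕ}
    (hn : 0 ≤ t n) (hσ : 0 < σ n) :
    σ n ≤ K ^ 2 * C ^ 2 * Real.exp ((χ + m * θ) * t n) * width N F M t σ n := by
  have hC : 0 ≤ C := zero_le_one.trans h.one_le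
  have h1 : opNorm N (Mn F M t n).1 ≤ K ^ 2 * (C * Real.exp (m * θ * t n)) :=
    (hN.opNorm_le _).trans (mul_le_mul_of_nonneg_left (h.Mn_le hn) (sq_nonneg _))
  have hp := hN.opNorm_pos (Mn F M t n)
  have e : σ n * |gamn F M t n| = width N F M t σ n * opNorm N (Mn F M t n).1 := by
    rw [width, div_mul_cancel₀ _ hp.ne']
  have hw := (h.width_pos hN hn hσ).le
  calc σ n ≤ σ n * (C * Real.exp (χ * t n) * |gamn F M t n|) :=
        le_mul_of_one_le_right hσ.le (h.gamn_lower hn)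
    _ = C * Real.exp (χ * t n) * (width N F M t σ n * opNorm N (Mn F M t n).1) := by
        rw [← e]; ring
    _ ≤ C * Real.exp (χ * t n) *
        (width N F M t σ n * (K ^ 2 * (C * Real.exp (m * θ * t n)))) := by gcongr
    _ = K ^ 2 * C ^ 2 * (Real.exp (χ * t n) * Real.exp (m * θ * t n)) * width N F M t σ n := by
        ring
    _ = _ := by rw [← Real.exp_add]; ring_nf

/-- Halving, rather than mere decrease, makes the difference in the third term of `Θ_n` at least
half the width, which gives positivity and a usable bound on its inverse. -/
lemma OrbitBound.width_succ_le (h : OrbitBound F M C θ χ) (hN : NormEquiv N K) {n : ℕ}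
    (hn : 0 ≤ t n) (hσ : 0 < σ n) (hσ' : 0 ≤ σ (n + 1))
    (hle : 2 * K ^ 4 * C ^ 2 * (σ (n + 1) * Real.exp ((χ + m * θ) * t n)) ≤
      σ n * Real.exp (((m : ℝ) + 1) * dt t (n + 1))) :
    width N F M t σ (n + 1) / Real.exp (((m : ℝ) + 1) * dt t (n + 1)) ≤
      width N F M t σ n / 2 := by
  have hC : 0 < C := zero_lt_one.trans_le h.one_le
  have hK : 0 < K := zero_lt_one.trans_le hN.1
  rw [div_le_iff₀ (Real.exp_pos _)]
  refine (hN.width_le hσ').trans ?_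
  set X := Real.exp ((χ + m * θ) * t n) with hX
  set Y := Real.exp (((m : ℝ) + 1) * dt t (n + 1)) with hY
  have hX0 : 0 < X := Real.exp_pos _
  have hY0 : 0 < Y := Real.exp_pos _
  have h1 := h.width_ge hN hn hσ
  set w := width N F M t σ n with hw
  have h2 : (2 * K ^ 2 * C ^ 2 * X) * (σ (n + 1) * K ^ 2) ≤ (2 * K ^ 2 * C ^ 2 * X) * (w / 2 * Y) := by
    calc (2 * K ^ 2 * C ^ 2 * X) * (σ (n + 1) * K ^ 2)
        = 2 * K ^ 4 * C ^ 2 * (σ (n + 1) * X) := by ring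
      _ ≤ σ n * Y := hle
      _ ≤ K ^ 2 * C ^ 2 * X * w * Y := by gcongr
      _ = _ := by ring
  exact le_of_mul_le_mul_left h2 (by positivity)

lemma omn_ne_zero {n : ℕ} (h0 : gamn F M t n ≠ 0) : omn F M t n ≠ 0 := fun h => by
  have h1 := congrFun h (Fin.last m)
  have h2 : omn F M t n (Fin.last m) = (gamn F M t n)⁻¹ * gamn F M t n := by
    simp [omn, gamn, gam]
  rw [h2, inv_mul_cancel₀ h0] at h1
  exact one_ne_zero h1

lemma epsn_pos (hN : NormEquiv N K) {n : ℕ} (h0 : gamn F M t n ≠ 0) (hσ : 0 < σ n) {ν : ℝ}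
    (hν : 0 < ν) : 0 < epsn N F M t σ ν n := by
  have := hN.pos (omn_ne_zero h0)
  have := Real.pi_pos
  unfold epsn
  positivity

lemma Thetan_pos (hN : NormEquiv N K) {n : ℕ} (h0 : gamn F M t n ≠ 0) (hσ : 0 < σ n) {ν lam : ℝ}
    (hν : 0 < ν) (hlam : 0 < lam) (hw : 0 < width N F M t σ n)
    (hww : width N F M t σ (n + 1) / Real.exp (((m : ℝ) + 1) * dt t (n + 1)) ≤
      width N F M t σ n / 2) : 0 < Thetan N F M t σ ν lam n := by
  refine lt_min (epsn_pos hN h0 hσ hν) (lt_min ?_ ?_)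
  · exact div_pos (by positivity) (Finset.prod_pos fun i _ => pow_pos (hN.opNorm_pos _) 2)
  · refine mul_pos (by positivity) (div_pos (by linarith) ?_)
    have := opNorm_nonneg N ((Mn F M t n)⁻¹).1
    positivity

lemma Thetan_le {n : ℕ} (hσ : 0 < σ n) (hσ1 : σ n < 1) {ν lam : ℝ} (hν : 0 < ν) :
    Thetan N F M t σ ν lam n ≤ ν := by
  refine (min_le_left _ _).trans ?_
  have h1 : ν / (4 * Real.pi) ≤ ν := div_le_self hν.le (by nlinarith [Real.pi_gt_three])
  calc epsn N F M t σ ν n ≤ σ n / 42 * ν :=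
        mul_le_mul_of_nonneg_left ((min_le_left _ _).trans h1) (by positivity)
    _ ≤ 1 * ν := mul_le_mul_of_nonneg_right (by linarith) hν.le
    _ = ν := one_mul ν

/-- For positive numbers, the inverse of a minimum is at most the sum of the inverses. The minimum
defining `Θ_n` thus becomes a sum of products, to which exponential bounds apply termwise. -/
lemma inv_Thetan_le (hN : NormEquiv N K) {n : ℕ} (h0 : gamn F M t n ≠ 0) (hσ : 0 < σ n)
    {ν lam : ℝ} (hν : 0 < ν) (hlam : 0 < lam) (hw : 0 < width N F M t σ n)
    (hww : width N F M t σ (n + 1) / Real.exp (((m : ℝ) + 1) * dt t (n + 1)) ≤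
      width N F M t σ n / 2) :
    (Thetan N F M t σ ν lam n)⁻¹ ≤
      42 * (σ n)⁻¹ * (4 * Real.pi * ν⁻¹ + 72 * N (omn F M t n) * (σ n)⁻¹) +
      ((lam⁻¹) ^ n * ((σ n)⁻¹ * (σ n)⁻¹) *
          ∏ i ∈ Finset.Icc 1 n, opNorm N ((Tn F M t i)⁻¹).1 ^ 2 +
        2 * ((lam⁻¹) ^ n * (1 + |gamn F M t n| * opNorm N ((Mn F M t n)⁻¹).1) *
          (width N F M t σ n)⁻¹)) := by
  have hmin : ∀ a b : ℝ, 0 < a → 0 < b → (min a b)⁻¹ ≤ a⁻¹ + b⁻¹ := by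
    intro a b ha hb
    have ha' := inv_pos.2 ha
    have hb' := inv_pos.2 hb
    rcases min_choice a b with h | h <;> rw [h] <;> linarith
  have hπ := Real.pi_pos
  have hom := hN.pos (omn_ne_zero h0)
  have hop := opNorm_nonneg N ((Mn F M t n)⁻¹).1
  have hprod : 0 < ∏ i ∈ Finset.Icc 1 n, opNorm N ((Tn F M t i)⁻¹).1 ^ 2 :=
    Finset.prod_pos fun i _ => pow_pos (hN.opNorm_pos _) 2
  have hdiff : width N F M t σ n / 2 ≤ width N F M t σ n -
      width N F M t σ (n + 1) / Real.exp (((m : ℝ) + 1) * dt t (n + 1)) := by linarith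
  have hD : 0 < 1 + |gamn F M t n| * opNorm N ((Mn F M t n)⁻¹).1 := by positivity
  have hdp : 0 < width N F M t σ n -
      width N F M t σ (n + 1) / Real.exp (((m : ℝ) + 1) * dt t (n + 1)) := by linarith
  have heps := epsn_pos hN h0 hσ hν
  unfold Thetan
  unfold epsn at heps ⊢
  generalize (∏ i ∈ Finset.Icc 1 n, opNorm N ((Tn F M t i)⁻¹).1 ^ 2) = p at *
  generalize 1 + |gamn F M t n| * opNorm N ((Mn F M t n)⁻¹).1 = D at *
  generalize width N F M t σ n - width N F M t σ (n + 1) /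
    Real.exp (((m : ℝ) + 1) * dt t (n + 1)) = w' at *
  generalize width N F M t σ n = w at *
  generalize N (omn F M t n) = a at *
  generalize σ n = s at *
  refine (hmin _ _ heps (lt_min (by positivity) (by positivity))).trans ?_
  refine add_le_add ?_ ((hmin _ _ (by positivity) (by positivity)).trans (add_le_add ?_ ?_))
  · rw [mul_inv, inv_div, div_eq_mul_inv]
    refine mul_le_mul_of_nonneg_left ((hmin _ _ (by positivity) (by positivity)).trans ?_)
      (by positivity)
    rw [inv_div, inv_div]
    exact le_of_eq (by ring)
  · rw [inv_div, inv_pow]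
    exact le_of_eq (by field_simp)
  · rw [mul_inv, inv_div, inv_pow]
    have h2 := inv_anti₀ (by positivity) hdiff
    rw [inv_div] at h2
    calc (lam ^ n)⁻¹ * (D / w') = (lam ^ n)⁻¹ * (D * w'⁻¹) := by rw [div_eq_mul_inv]
      _ ≤ (lam ^ n)⁻¹ * (D * (2 / w)) := by gcongr
      _ = _ := by ring

end Step

/-! ### Exponentially bounded sequences -/

/-- `f n ≤ e^{Q t_n}` for some `Q ≥ 0` and all `n ≥ 1`. -/
def ExpBdd (t f : ℕ → ℝ) : Prop := ∃ Q : ℝ, 0 ≤ Q ∧ ∀ n, 1 ≤ n → f n ≤ Real.exp (Q * t n)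

section ExpBdd

variable {t f g : ℕ → ℝ}

lemma ExpBdd.mono (hf : ExpBdd t f) (h : ∀ n, 1 ≤ n → g n ≤ f n) : ExpBdd t g := by
  obtain ⟨Q, hQ, hf⟩ := hf
  exact ⟨Q, hQ, fun n hn => (h n hn).trans (hf n hn)⟩

lemma expBdd_const (ht : ∀ n, 1 ≤ n → 1 ≤ t n) (c : ℝ) : ExpBdd t fun _ => c := by
  refine ⟨|c|, abs_nonneg _, fun n hn => ?_⟩
  have h1 := Real.add_one_le_exp (|c| * t n)
  have h2 := le_abs_self c
  nlinarith [ht n hn, abs_nonneg c]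

lemma expBdd_exp (ht : ∀ n, 1 ≤ n → 1 ≤ t n) (c : ℝ) : ExpBdd t fun n => Real.exp (c * t n) := by
  refine ⟨|c|, abs_nonneg _, fun n hn => Real.exp_le_exp.2 ?_⟩
  exact mul_le_mul_of_nonneg_right (le_abs_self c) (zero_le_one.trans (ht n hn))

lemma ExpBdd.mul (hf : ExpBdd t f) (hg : ExpBdd t g) (hg0 : ∀ n, 0 ≤ g n) :
    ExpBdd t fun n => f n * g n := by
  obtain ⟨Q, hQ, hf⟩ := hf
  obtain ⟨R, hR, hg⟩ := hg
  refine ⟨Q + R, add_nonneg hQ hR, fun n hn => ?_⟩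
  rw [add_mul, Real.exp_add]
  exact mul_le_mul (hf n hn) (hg n hn) (hg0 n) (Real.exp_pos _).le

/-- The extra `1` in the exponent supplies `e^{t_n} ≥ 2`, which absorbs the two summands. -/
lemma ExpBdd.add (ht : ∀ n, 1 ≤ n → 1 ≤ t n) (hf : ExpBdd t f) (hg : ExpBdd t g) :
    ExpBdd t fun n => f n + g n := by
  obtain ⟨Q, hQ, hf⟩ := hf
  obtain ⟨R, hR, hg⟩ := hg
  refine ⟨Q + R + 1, by positivity, fun n hn => ?_⟩
  have h1 := ht n hn
  have h0 : 0 ≤ t n := zero_le_one.trans h1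
  have e2 : Real.exp ((Q + R + 1) * t n) = Real.exp (t n) * Real.exp ((Q + R) * t n) := by
    rw [← Real.exp_add]; ring_nf
  have e3 := Real.add_one_le_exp (t n)
  have hQ' : Real.exp (Q * t n) ≤ Real.exp ((Q + R) * t n) := Real.exp_le_exp.2 (by nlinarith)
  have hR' : Real.exp (R * t n) ≤ Real.exp ((Q + R) * t n) := Real.exp_le_exp.2 (by nlinarith)
  rw [e2]
  nlinarith [hf n hn, hg n hn, Real.exp_pos ((Q + R) * t n)]

lemma ExpBdd.pow_two (hf : ExpBdd t f) (hf0 : ∀ n, 0 ≤ f n) : ExpBdd t fun n => f n ^ 2 := by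
  simpa only [sq] using hf.mul hf hf0

lemma ExpBdd.shift (ht : ∀ n, 1 ≤ n → 1 ≤ t n) (hmono : Monotone t) (hf : ExpBdd t f) :
    ExpBdd t fun n => f (n - 1) := by
  obtain ⟨Q, hQ, hf⟩ := hf
  -- At `n = 1` the shifted sequence takes the value `f 0`, about which the bound on `f` says
  -- nothing.
  obtain ⟨R, hR, hg⟩ := expBdd_const ht (f 0)
  refine ⟨Q + R, add_nonneg hQ hR, fun n hn => ?_⟩
  have h0 : 0 ≤ t n := zero_le_one.trans (ht n hn)
  obtain ⟨k, rfl⟩ := Nat.exists_eq_add_of_le' hn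
  beta_reduce
  rw [Nat.add_sub_cancel]
  rcases Nat.eq_zero_or_pos k with rfl | hk
  · exact (hg _ hn).trans (Real.exp_le_exp.2 (by nlinarith))
  · refine (hf k hk).trans (Real.exp_le_exp.2 ?_)
    have h1 : t k ≤ t (k + 1) := hmono (Nat.le_succ k)
    nlinarith [mul_le_mul_of_nonneg_left h1 hQ, mul_nonneg hR h0]

lemma expBdd_pow (htn : ∀ n : ℕ, 1 ≤ n → (n : ℝ) ≤ t n) {c : ℝ} (hc : 1 ≤ c) :
    ExpBdd t fun n => c ^ n := by
  refine ⟨Real.log c, Real.log_nonneg hc, fun n hn => ?_⟩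
  have e : c ^ n = Real.exp (Real.log c * n) := by
    rw [mul_comm, Real.exp_nat_mul, Real.exp_log (zero_lt_one.trans_le hc)]
  beta_reduce
  rw [e]
  refine Real.exp_le_exp.2 ?_
  exact mul_le_mul_of_nonneg_left (htn n hn) (Real.log_nonneg hc)

/-- Doubling times satisfy `t_1 + ⋯ + t_n ≤ 2 t_n`, so a product over the whole history costs no
more than twice the exponent of its last factor. -/
lemma ExpBdd.prod (hf : ExpBdd t f) (hf0 : ∀ n, 0 ≤ f n) (h1 : 0 ≤ t 1)
    (hgrow : ∀ n, 1 ≤ n → 2 * t n ≤ t (n + 1)) :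
    ExpBdd t fun n => ∏ i ∈ Finset.Icc 1 n, f i := by
  obtain ⟨Q, hQ, hf⟩ := hf
  refine ⟨2 * Q, by positivity, fun n hn => ?_⟩
  beta_reduce
  induction n, hn using Nat.le_induction with
  | base =>
    rw [Finset.Icc_self, Finset.prod_singleton]
    refine (hf 1 le_rfl).trans (Real.exp_le_exp.2 ?_)
    nlinarith [mul_nonneg hQ h1]
  | succ n hn ih =>
    rw [Finset.prod_Icc_succ_top (by omega)]
    have h := hf (n + 1) (by omega)
    calc (∏ i ∈ Finset.Icc 1 n, f i) * f (n + 1)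
        ≤ Real.exp (2 * Q * t n) * Real.exp (Q * t (n + 1)) :=
          mul_le_mul ih h (hf0 _) (Real.exp_pos _).le
      _ = Real.exp (2 * Q * t n + Q * t (n + 1)) := by rw [Real.exp_add]
      _ ≤ _ := Real.exp_le_exp.2 (by nlinarith [mul_le_mul_of_nonneg_left (hgrow n hn) hQ])

end ExpBdd

/-! ### Exponential bounds for the scheme -/

section Bounds

variable {m : ℕ} {N : Seminorm ℝ (Fin (m + 1) → ℝ)} {F : Set (G m)} {M : G m} {t σ : ℕ → ℝ}
  {K C θ χ : ℝ}

lemma OrbitBound.expBdd_Mn (h : OrbitBound F M C θ χ) (ht0 : ∀ n, 0 ≤ t n)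
    (ht : ∀ n, 1 ≤ n → 1 ≤ t n) : ExpBdd t fun n => entrySum (Mn F M t n).1 :=
  ((expBdd_const ht C).mul (expBdd_exp ht (m * θ)) fun _ => (Real.exp_pos _).le).mono
    fun n _ => h.Mn_le (ht0 n)

lemma OrbitBound.expBdd_Mn_inv (h : OrbitBound F M C θ χ) (ht0 : ∀ n, 0 ≤ t n)
    (ht : ∀ n, 1 ≤ n → 1 ≤ t n) : ExpBdd t fun n => entrySum ((Mn F M t n)⁻¹).1 :=
  ((expBdd_const ht C).mul (expBdd_exp ht θ) fun _ => (Real.exp_pos _).le).mono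
    fun n _ => h.Mn_inv_le (ht0 n)

lemma OrbitBound.expBdd_gamn_inv (h : OrbitBound F M C θ χ) (ht0 : ∀ n, 0 ≤ t n)
    (ht : ∀ n, 1 ≤ n → 1 ≤ t n) : ExpBdd t fun n => |gamn F M t n|⁻¹ :=
  ((expBdd_const ht C).mul (expBdd_exp ht χ) fun _ => (Real.exp_pos _).le).mono
    fun n _ => h.gamn_inv_le (ht0 n)

lemma OrbitBound.expBdd_gamn (h : OrbitBound F M C θ χ) (ht0 : ∀ n, 0 ≤ t n)
    (ht : ∀ n, 1 ≤ n → 1 ≤ t n) : ExpBdd t fun n => |gamn F M t n| :=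
  (h.expBdd_Mn ht0 ht).mono fun _ _ => abs_le_entrySum _ _ _

lemma expBdd_exp_dt (ht0 : ∀ n, 0 ≤ t n) (ht : ∀ n, 1 ≤ n → 1 ≤ t n) {c : ℝ} (hc : 0 ≤ c) :
    ExpBdd t fun n => Real.exp (c * dt t n) :=
  (expBdd_exp ht c).mono fun n _ => Real.exp_le_exp.2
    (mul_le_mul_of_nonneg_left (by rw [dt]; linarith [ht0 (n - 1)]) hc)

lemma OrbitBound.expBdd_Tn (h : OrbitBound F M C θ χ) (ht0 : ∀ n, 0 ≤ t n)
    (ht : ∀ n, 1 ≤ n → 1 ≤ t n) (hmono : Monotone t) :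
    ExpBdd t fun n => entrySum (Tn F M t n).1 := by
  have hE : ExpBdd t fun n => entrySum (E m (-dt t n)).1 := by
    refine ((expBdd_const ht ((m : ℝ) + 1)).mul (expBdd_exp_dt ht0 ht zero_le_one)
      fun _ => (Real.exp_pos _).le).mono fun n _ => ?_
    rw [one_mul]
    exact entrySum_E_neg_le m (sub_nonneg.2 (hmono (Nat.sub_le n 1)))
  refine (((h.expBdd_Mn ht0 ht).mul hE fun _ => entrySum_nonneg _).mul
    ((h.expBdd_Mn_inv ht0 ht).shift ht hmono) fun _ => entrySum_nonneg _).mono fun n _ => ?_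
  rw [Tn_eq]
  exact (entrySum_coe_mul_le _ _).trans
    (mul_le_mul_of_nonneg_right (entrySum_coe_mul_le _ _) (entrySum_nonneg _))

lemma OrbitBound.expBdd_Tn_inv (h : OrbitBound F M C θ χ) (ht0 : ∀ n, 0 ≤ t n)
    (ht : ∀ n, 1 ≤ n → 1 ≤ t n) (hmono : Monotone t) :
    ExpBdd t fun n => entrySum ((Tn F M t n)⁻¹).1 := by
  have hE : ExpBdd t fun n => entrySum (E m (dt t n)).1 :=
    ((expBdd_const ht ((m : ℝ) + 1)).mul (expBdd_exp_dt ht0 ht (Nat.cast_nonneg m))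
      fun _ => (Real.exp_pos _).le).mono fun n _ =>
        entrySum_E_le m (sub_nonneg.2 (hmono (Nat.sub_le n 1)))
  refine ((((h.expBdd_Mn ht0 ht).shift ht hmono).mul hE fun _ => entrySum_nonneg _).mul
    (h.expBdd_Mn_inv ht0 ht) fun _ => entrySum_nonneg _).mono fun n _ => ?_
  rw [Tn_inv_eq]
  exact (entrySum_coe_mul_le _ _).trans
    (mul_le_mul_of_nonneg_right (entrySum_coe_mul_le _ _) (entrySum_nonneg _))

lemma NormEquiv.expBdd_opNorm (hN : NormEquiv N K) (ht : ∀ n, 1 ≤ n → 1 ≤ t n)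
    {B : ℕ → Matrix (Fin (m + 1)) (Fin (m + 1)) ℝ} (hB : ExpBdd t fun n => entrySum (B n)) :
    ExpBdd t fun n => opNorm N (B n) :=
  ((expBdd_const ht (K ^ 2)).mul hB fun _ => entrySum_nonneg _).mono fun n _ => hN.opNorm_le (B n)

lemma OrbitBound.expBdd_omn (h : OrbitBound F M C θ χ) (hN : NormEquiv N K) (ht0 : ∀ n, 0 ≤ t n)
    (ht : ∀ n, 1 ≤ n → 1 ≤ t n) : ExpBdd t fun n => N (omn F M t n) := by
  refine ((((expBdd_const ht (K ^ 2)).mul (h.expBdd_Mn ht0 ht) fun _ => entrySum_nonneg _).mul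
    (expBdd_const ht (N (Pi.single (Fin.last m) 1))) fun _ => apply_nonneg _ _).mul
    (h.expBdd_gamn_inv ht0 ht) fun _ => inv_nonneg.2 (abs_nonneg _)).mono fun n _ => ?_
  rw [omn, map_smul_eq_mul, norm_inv, Real.norm_eq_abs, mul_comm]
  exact mul_le_mul_of_nonneg_right (hN.mulVec_le _ _) (inv_nonneg.2 (abs_nonneg _))

lemma OrbitBound.expBdd_etan (h : OrbitBound F M C θ χ) (hM : gam M ≠ 0) (ht0 : ∀ n, 0 ≤ t n)
    (ht : ∀ n, 1 ≤ n → 1 ≤ t n) (hmono : Monotone t) : ExpBdd t fun n => |etan F M t n| := by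
  refine (((h.expBdd_gamn_inv ht0 ht).mul ((h.expBdd_gamn ht0 ht).shift ht hmono)
    fun _ => abs_nonneg _).mul (expBdd_exp ht m) fun _ => (Real.exp_pos _).le).mono fun n _ => ?_
  have h1 := h.gamn_ne_zero (ht0 n)
  have h2 := h.gamn_ne_zero (ht0 (n - 1))
  have h3 : etan F M t n = (gamn F M t n)⁻¹ * gamn F M t (n - 1) *
      Real.exp (m * t n) * (Real.exp (m * t (n - 1)))⁻¹ := by
    have h4 := (Real.exp_pos (m * t (n - 1))).ne'
    rw [etan, lamn, lamn]
    field_simp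
  rw [h3, abs_mul, abs_mul, abs_mul, abs_inv, abs_of_pos (Real.exp_pos _),
    abs_of_pos (inv_pos.2 (Real.exp_pos _))]
  refine mul_le_of_le_one_right (by positivity) (inv_le_one_of_one_le₀ (Real.one_le_exp ?_))
  exact mul_nonneg (Nat.cast_nonneg m) (ht0 _)

lemma OrbitBound.expBdd_inv_Thetan (h : OrbitBound F M C θ χ) (hN : NormEquiv N K)
    (ht0 : ∀ n, 0 ≤ t n) (htn : ∀ n : ℕ, 1 ≤ n → (n : ℝ) ≤ t n) (hmono : Monotone t)
    (hgrow : ∀ n, 1 ≤ n → 2 * t n ≤ t (n + 1)) (hσ : ∀ n, 0 < σ n)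
    (hσb : ExpBdd t fun n => (σ n)⁻¹) {ν lam : ℝ} (hν : 0 < ν) (hlam : 0 < lam) (hlam1 : lam < 1)
    (hww : ∀ n, width N F M t σ (n + 1) / Real.exp (((m : ℝ) + 1) * dt t (n + 1)) ≤
      width N F M t σ n / 2) :
    ExpBdd t fun n => (Thetan N F M t σ ν lam n)⁻¹ := by
  have ht : ∀ n, 1 ≤ n → 1 ≤ t n := fun n hn =>
    le_trans (by exact_mod_cast hn) (htn n hn)
  have hσ0 : ∀ n, 0 ≤ (σ n)⁻¹ := fun n => (inv_pos.2 (hσ n)).le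
  have hlamp : ExpBdd t fun n => (lam⁻¹) ^ n := expBdd_pow htn (one_le_inv_iff₀.2 ⟨hlam, hlam1.le⟩)
  have hwp : ∀ n, 0 < width N F M t σ n := fun n => h.width_pos hN (ht0 n) (hσ n)
  have hwb : ExpBdd t fun n => (width N F M t σ n)⁻¹ := by
    refine ((hσb.mul (h.expBdd_gamn_inv ht0 ht) fun _ => inv_nonneg.2 (abs_nonneg _)).mul
      (hN.expBdd_opNorm ht (h.expBdd_Mn ht0 ht)) fun _ => opNorm_nonneg _ _).mono fun n _ => ?_
    rw [width, inv_div, div_eq_mul_inv, mul_inv]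
    exact le_of_eq (by ring)
  have hprod := (((hN.expBdd_opNorm ht (h.expBdd_Tn_inv ht0 ht hmono)).pow_two
    fun _ => opNorm_nonneg _ _).prod (fun _ => sq_nonneg _) (ht0 1) hgrow)
  have hprod0 : ∀ n, 0 ≤ ∏ i ∈ Finset.Icc 1 n, opNorm N ((Tn F M t i)⁻¹).1 ^ 2 := fun n =>
    Finset.prod_nonneg fun _ _ => sq_nonneg _
  have hop0 : ∀ n, 0 ≤ opNorm N ((Mn F M t n)⁻¹).1 := fun n => opNorm_nonneg _ _
  have hA := ((expBdd_const ht 42).mul hσb hσ0).mul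
    ((expBdd_const ht (4 * Real.pi * ν⁻¹)).add ht
      (((expBdd_const ht 72).mul (h.expBdd_omn hN ht0 ht) fun _ => apply_nonneg _ _).mul hσb hσ0))
    (fun n => by
      have := Real.pi_pos
      have h1 : 0 ≤ N (omn F M t n) := apply_nonneg _ _
      have h2 := hσ0 n
      positivity)
  have hB := (hlamp.mul (hσb.mul hσb hσ0) fun n => mul_nonneg (hσ0 n) (hσ0 n)).mul hprod hprod0
  have hD := (expBdd_const ht 2).mul
    ((hlamp.mul ((expBdd_const ht 1).add ht
      ((h.expBdd_gamn ht0 ht).mul (hN.expBdd_opNorm ht (h.expBdd_Mn_inv ht0 ht)) hop0))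
      (fun n => by have := hop0 n; positivity)).mul hwb fun n => (inv_pos.2 (hwp n)).le)
    (fun n => by
      have := hop0 n
      have := hwp n
      positivity)
  exact (hA.add ht (hB.add ht hD)).mono fun n _ =>
    inv_Thetan_le hN (h.gamn_ne_zero (ht0 n)) (hσ n) hν hlam (hwp n) (hww n)

/-- The numerator `Θ_{n-1}` is at most `ν`, so only `1/Θ_n` and the sizes of `η_n` and `T^{(n)}`
matter. -/
lemma OrbitBound.expBdd_phin (h : OrbitBound F M C θ χ) (hN : NormEquiv N K) (hM : gam M ≠ 0)
    (ht0 : ∀ n, 0 ≤ t n) (htn : ∀ n : ℕ, 1 ≤ n → (n : ℝ) ≤ t n) (hmono : Monotone t)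
    (hgrow : ∀ n, 1 ≤ n → 2 * t n ≤ t (n + 1)) (hσ : ∀ n, 0 < σ n) (hσ1 : ∀ n, σ n < 1)
    (hσb : ExpBdd t fun n => (σ n)⁻¹) {ν δ lam : ℝ} (hν : 0 < ν) (hδ : 0 < δ) (hlam : 0 < lam)
    (hlam1 : lam < 1)
    (hww : ∀ n, width N F M t σ (n + 1) / Real.exp (((m : ℝ) + 1) * dt t (n + 1)) ≤
      width N F M t σ n / 2) :
    ExpBdd t fun n => phin N F M t σ ν δ lam n := by
  have ht : ∀ n, 1 ≤ n → 1 ≤ t n := fun n hn =>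
    le_trans (by exact_mod_cast hn) (htn n hn)
  have hΘ : ∀ n, 0 < Thetan N F M t σ ν lam n := fun n =>
    Thetan_pos hN (h.gamn_ne_zero (ht0 n)) (hσ n) hν hlam (h.width_pos hN (ht0 n) (hσ n)) (hww n)
  have hc : 0 ≤ 1 + 2 * Real.pi / δ := by have := Real.pi_pos; positivity
  refine ((((((expBdd_const ht 2).mul (h.expBdd_etan hM ht0 ht hmono) fun _ => abs_nonneg _).mul
    (hN.expBdd_opNorm ht (h.expBdd_Tn ht0 ht hmono)) fun _ => opNorm_nonneg _ _).mul
    (expBdd_const ht (1 + 2 * Real.pi / δ)) fun _ => hc).mul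
    ((expBdd_const ht ν).mul
      (h.expBdd_inv_Thetan hN ht0 htn hmono hgrow hσ hσb hν hlam hlam1 hww)
        fun n => (inv_pos.2 (hΘ n)).le)
      fun n => mul_nonneg hν.le (inv_pos.2 (hΘ n)).le).add ht (expBdd_const ht 1)).mono
    fun n _ => ?_
  have hT0 := opNorm_nonneg N (Tn F M t n).1
  have hΘ' := inv_pos.2 (hΘ n)
  have hpos : 0 ≤ 2 * |etan F M t n| * opNorm N (Tn F M t n).1 * (1 + 2 * Real.pi / δ) := by
    positivity
  refine max_le ?_ ?_
  · refine le_trans (mul_le_mul_of_nonneg_left ?_ hpos) (le_add_of_nonneg_right zero_le_one)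
    rw [div_eq_mul_inv]
    exact mul_le_mul_of_nonneg_right (Thetan_le (hσ _) (hσ1 _) hν) hΘ'.le
  · exact le_add_of_nonneg_left (mul_nonneg hpos (mul_nonneg hν.le hΘ'.le))

/-- `𝓑` is finite when the cones contract by a factor that beats the growth of the times. -/
lemma calB_lt_top (ht1 : ∀ n, 1 ≤ t (n + 1)) {q ν δ lam : ℝ} (hq : 0 < q)
    (ht : ∀ n, t (n + 2) = q * t (n + 1))
    (hA : ∀ n, An N F M t σ (n + 1) * q ≤ 1 / 2)
    (hφ : ExpBdd t fun n => phin N F M t σ ν δ lam n) :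
    calB N F M t σ ν δ lam < ⊤ := by
  obtain ⟨Q, hQ, hφ⟩ := hφ
  set B := Bn N F M t σ with hB
  have hB0 : ∀ n, 0 ≤ B n := Bn_nonneg N F M t σ
  set D := B 0 * t 1 with hD
  -- Each step multiplies `B_n` by `A_{n+1}` and the time by `q`, in total by at most `1/2`. The
  -- factor `A_0` is not estimated; it sits in the constant `D`.
  have hdec : ∀ n, B n * t (n + 1) ≤ D * (1 / 2) ^ n := by
    intro n
    induction n with
    | zero => simp [hD]
    | succ n ih =>
      have e : B (n + 1) = B n * An N F M t σ (n + 1) := Finset.prod_range_succ _ _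
      have h0 : 0 ≤ B n * t (n + 1) := mul_nonneg (hB0 n) (zero_le_one.trans (ht1 n))
      calc B (n + 1) * t (n + 1 + 1) = (B n * t (n + 1)) * (An N F M t σ (n + 1) * q) := by
            rw [e, ht]; ring
        _ ≤ (D * (1 / 2) ^ n) * (1 / 2) :=
            mul_le_mul ih (hA n) (mul_nonneg (An_nonneg _ _ _ _ _ _) hq.le) (h0.trans ih)
        _ = _ := by ring
  have hgeom : Summable fun n : ℕ => ((1 : ℝ) / 2) ^ n :=
    summable_geometric_of_lt_one (by norm_num) (by norm_num)
  have hfin : ∀ (f : ℕ → ℝ) (c : ℝ), (∀ n, f n ≤ c * (1 / 2) ^ n) →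
      ∑' i, ENNReal.ofReal (f i) < ⊤ := fun f c hf =>
    (ENNReal.tsum_le_tsum fun i => ENNReal.ofReal_le_ofReal (hf i)).trans_lt
      (hgeom.mul_left c).tsum_ofReal_lt_top
  have hBle : ∀ n, B n ≤ B n * t (n + 1) := fun n => le_mul_of_one_le_right (hB0 n) (ht1 n)
  refine ENNReal.add_lt_top.2 ⟨hfin _ (Q * D) fun n => ?_,
    ENNReal.mul_lt_top ENNReal.ofReal_lt_top (hfin _ D fun n => (hBle n).trans (hdec n))⟩
  have hlog : Real.log (phin N F M t σ ν δ lam (n + 1)) ≤ Q * t (n + 1) :=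
    (Real.log_le_iff_le_exp (zero_lt_one.trans_le (le_max_right _ _))).2 (hφ _ (Nat.succ_pos n))
  calc B n * Real.log (phin N F M t σ ν δ lam (n + 1)) ≤ B n * (Q * t (n + 1)) :=
        mul_le_mul_of_nonneg_left hlog (hB0 n)
    _ = Q * (B n * t (n + 1)) := by ring
    _ ≤ Q * (D * (1 / 2) ^ n) := mul_le_mul_of_nonneg_left (hdec n) hQ
    _ = _ := by ring

end Bounds

/-! ### The stopping times and the widths -/

/-- The times `0, s, s (1 + ξ), s (1 + ξ)^2, …`. -/
def geomTimes (s ξ : ℝ) : ℕ → ℝ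
  | 0 => 0
  | n + 1 => s * (1 + ξ) ^ n

/-- The widths `1 / 2, e^{-c δt_1}, e^{-c δt_2}, …`. -/
def expWidths (t : ℕ → ℝ) (c : ℝ) : ℕ → ℝ
  | 0 => 1 / 2
  | n + 1 => Real.exp (-c * dt t (n + 1))

section Times

variable {s ξ : ℝ}

lemma geomTimes_succ_succ (s ξ : ℝ) (n : ℕ) :
    geomTimes s ξ (n + 2) = (1 + ξ) * geomTimes s ξ (n + 1) := by
  simp only [geomTimes]; ring

lemma le_geomTimes_succ (hs : 0 ≤ s) (hξ : 0 ≤ ξ) (n : ℕ) : s ≤ geomTimes s ξ (n + 1) :=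
  le_mul_of_one_le_right hs (one_le_pow₀ (by linarith))

lemma geomTimes_strictMono (hs : 0 < s) (hξ : 0 < ξ) : StrictMono (geomTimes s ξ) := by
  refine strictMono_nat_of_lt_succ fun n => ?_
  cases n with
  | zero => simpa [geomTimes] using hs
  | succ n =>
    rw [geomTimes_succ_succ]
    nlinarith [le_geomTimes_succ hs.le hξ.le n]

lemma natCast_le_geomTimes (hs : 1 ≤ s) (hξ : 1 ≤ ξ) (n : ℕ) : (n : ℝ) ≤ geomTimes s ξ n := by
  cases n with
  | zero => simp [geomTimes]
  | succ n =>
    have h1 : 1 + (n : ℝ) * ξ ≤ (1 + ξ) ^ n := one_add_mul_le_pow (by linarith) n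
    have h2 : (n : ℝ) ≤ n * ξ := le_mul_of_one_le_right (Nat.cast_nonneg n) hξ
    have h3 : (1 + ξ) ^ n ≤ geomTimes s ξ (n + 1) := le_mul_of_one_le_left (by positivity) hs
    push_cast
    linarith

lemma dt_geomTimes_one (s ξ : ℝ) : dt (geomTimes s ξ) 1 = s := by simp [dt, geomTimes]

lemma dt_geomTimes_succ_succ (s ξ : ℝ) (n : ℕ) :
    dt (geomTimes s ξ) (n + 2) = ξ * geomTimes s ξ (n + 1) := by
  have : dt (geomTimes s ξ) (n + 2) = geomTimes s ξ (n + 2) - geomTimes s ξ (n + 1) := rfl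
  rw [this, geomTimes_succ_succ]; ring

lemma dt_geomTimes_pos (hs : 0 < s) (hξ : 0 < ξ) (n : ℕ) : 0 < dt (geomTimes s ξ) (n + 1) :=
  sub_pos.2 (geomTimes_strictMono hs hξ (Nat.lt_succ_self n))

/-- An equality except at the first step, where `δt_2 = ξ s`. It relates the width `σ_n`, set by
`δt_n`, to the next step, for which the cone must be thin. -/
lemma dt_geomTimes_le (hs : 0 < s) (n : ℕ) :
    dt (geomTimes s ξ) (n + 2) ≤ (1 + ξ) * dt (geomTimes s ξ) (n + 1) := by
  cases n with
  | zero => rw [dt_geomTimes_one, dt_geomTimes_succ_succ]; simp [geomTimes]; nlinarith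
  | succ n =>
    rw [dt_geomTimes_succ_succ, dt_geomTimes_succ_succ, geomTimes_succ_succ]
    exact le_of_eq (by ring)

/-- Used to compare consecutive widths: the gain in `σ_{n+1}` over `σ_n` must also pay for the
growth of `M^{(n)}` and `1/γ^{(n)}` up to `t_n`. -/
lemma add_dt_geomTimes_le (hs : 0 < s) (hξ : 2 ≤ ξ) (n : ℕ) :
    geomTimes s ξ (n + 1) + dt (geomTimes s ξ) (n + 1) ≤ dt (geomTimes s ξ) (n + 2) := by
  cases n with
  | zero => rw [dt_geomTimes_one, dt_geomTimes_succ_succ]; simp [geomTimes]; nlinarith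
  | succ n =>
    rw [dt_geomTimes_succ_succ, dt_geomTimes_succ_succ, geomTimes_succ_succ]
    have := le_geomTimes_succ hs.le (by linarith : 0 ≤ ξ) n
    have h0 : 0 < geomTimes s ξ (n + 1) := hs.trans_le this
    have h2 : 1 + 2 * ξ ≤ ξ * (1 + ξ) := by nlinarith
    nlinarith

end Times

end MCF

end

/-! ### Choice of the constants and conclusion. -/

open MCF in
theorem mainTheorem12 (m : ℕ) (hm : 1 ≤ m) (ε : ℝ) (hε : 0 < ε) :
    ∃ ξ c : ℝ, 0 < ξ ∧ 0 < c ∧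
      ∀ (N : Seminorm ℝ (Fin (m + 1) → ℝ)), (∀ x, N x = 0 → x = 0) →
      ∀ (FN F : Set (MCF.G m)), MCF.IsCompactRegion FN → MCF.IsFundDomain F →
        F ⊆ MCF.siegelSet FN →
      ∀ (α : Fin m → ℝ), MCF.IsDiophantine α ε →
      ∀ (A : Matrix (Fin m) (Fin m) ℝ) (β : Fin m → ℝ) (γ : ℝ) (M : MCF.G m), 0 < γ →
        (M : Matrix (Fin (m + 1)) (Fin (m + 1)) ℝ) = MCF.paramMatrix α A β γ →
      ∀ ν δ lam : ℝ, 0 < ν → 0 < δ → 0 < lam → lam < 1 →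
      ∃ t σ : ℕ → ℝ,
        t 0 = 0 ∧ StrictMono t ∧ Filter.Tendsto t Filter.atTop Filter.atTop ∧
        (∀ n, 1 ≤ n → MCF.Pn F M t n ≠ MCF.Pn F M t (n - 1)) ∧
        (∀ n, 2 ≤ n → MCF.dt t n = ξ * t (n - 1)) ∧
        (∀ n, 0 < σ n ∧ σ n < 1) ∧
        (∀ n, 1 ≤ n → σ n = Real.exp (-c * MCF.dt t n)) ∧
        (∀ n, 0 < MCF.Thetan N F M t σ ν lam n) ∧
        MCF.calB N F M t σ ν δ lam < ⊤ := by
  have hm1 : (1 : ℝ) ≤ m := by exact_mod_cast hm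
  -- This is the rate at which the Diophantine bound balances the expansion of the last entry of a
  -- row.
  obtain ⟨θ, hθ0, hθ1, hτ⟩ : ∃ θ : ℝ, 0 ≤ θ ∧ θ < 1 ∧
      (m : ℝ) * (1 + ε) * (1 - θ) = m + θ := by
    have hpos : (0 : ℝ) < 1 + m * (1 + ε) := by positivity
    refine ⟨m * ε / (1 + m * (1 + ε)), by positivity, ?_, ?_⟩
    · rw [div_lt_one hpos]; nlinarith
    · field_simp; ring
  have hθ' : 0 < 1 - θ := by linarith
  set χ : ℝ := m * (1 + ε) * (1 + m * θ) with hχ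
  -- The left side is the contraction exponent of `A_n` per unit of `t_n` when `δt_{n+1} = ξ t_n`;
  -- `ξ ≥ 2` serves the comparison of steps.
  obtain ⟨ξ, hξ2, hξ⟩ : ∃ ξ : ℝ, 2 ≤ ξ ∧ ξ - θ * (1 + ξ) - m * θ = 2 * (1 - θ) := by
    refine ⟨2 + (m + 1) * θ / (1 - θ), le_add_of_nonneg_right (by positivity), ?_⟩
    have h1 : ((m : ℝ) + 1) * θ / (1 - θ) * (1 - θ) = (m + 1) * θ := div_mul_cancel₀ _ hθ'.ne'
    linear_combination h1
  have hξ0 : 0 < ξ := by linarith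
  have hχ0 : 0 ≤ χ + m * θ := by positivity
  -- The first summand makes the cones thin enough for the next time step; the second dominates the
  -- loss in comparing `σ_n` with the width.
  set c : ℝ := (m + 1) * (1 + ξ) + (χ + m * θ) with hc
  have hc0 : 0 < c := by positivity
  refine ⟨ξ, c, hξ0, hc0, ?_⟩
  intro N hN₀ FN F hFN hF hS α hα A β γ M hγ hM ν δ lam hν hδ hlam hlam1
  obtain ⟨K, hN⟩ := exists_normEquiv N hN₀
  have hMα : ∀ i : Fin m, M i.castSucc (Fin.last m) = γ * α i := fun i =>
    (congrFun (congrFun hM _) _).trans (paramMatrix_castSucc_last α A β γ i)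
  have hMγ : M (Fin.last m) (Fin.last m) = γ :=
    (congrFun (congrFun hM _) _).trans (paramMatrix_last_last α A β γ)
  obtain ⟨C, hC, hb⟩ := orbit_bounds hε hFN hF hS hα hγ hMα hMγ hθ0 hθ1 hτ
  have h : OrbitBound F M C θ χ := ⟨hC, fun s hs => (hb s hs).1, fun s hs => (hb s hs).2.1,
    fun s hs => (hb s hs).2.2⟩
  have hK : 1 ≤ K := hN.1
  -- One threshold for three demands on the first time `s`: distinct `P^{(n)}`, contraction of the
  -- cones and halving of the widths.
  set X : ℝ := 4 * K ^ 4 * C ^ 2 * (1 + ξ) with hX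
  obtain ⟨s, hs1, hXs⟩ : ∃ s : ℝ, 1 ≤ s ∧ X ≤ Real.exp ((1 - θ) * s) := by
    refine ⟨max 1 (X / (1 - θ)), le_max_left _ _, ?_⟩
    have h1 : X ≤ (1 - θ) * max 1 (X / (1 - θ)) := by
      rw [← div_le_iff₀' hθ']; exact le_max_right _ _
    linarith [Real.add_one_le_exp ((1 - θ) * max 1 (X / (1 - θ)))]
  have hs0 : 0 < s := by linarith
  have hC2 : 0 < C ^ 2 := by positivity
  have hK2 : 1 ≤ K ^ 2 := one_le_pow₀ hK
  have hK4 : K ^ 2 ≤ K ^ 4 := pow_le_pow_right₀ hK (by norm_num)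
  have hX1 : 4 * K ^ 4 * C ^ 2 ≤ X := le_mul_of_one_le_right (by positivity) (by linarith)
  have hX2 : C ^ 2 < X := by
    have : 4 * C ^ 2 ≤ 4 * K ^ 4 * C ^ 2 := by
      refine mul_le_mul_of_nonneg_right ?_ hC2.le
      linarith
    linarith
  have hX3 : 4 * K ^ 2 * C ^ 2 * (1 + ξ) ≤ X := by rw [hX]; gcongr
  set t := geomTimes s ξ with ht
  set σ := expWidths t c with hσ
  have hmono : StrictMono t := geomTimes_strictMono hs0 hξ0
  have ht0 : ∀ n, 0 ≤ t n := fun n => hmono.monotone (Nat.zero_le n)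
  have htn : ∀ n : ℕ, (n : ℝ) ≤ t n := natCast_le_geomTimes hs1 (by linarith)
  have hts : ∀ n, s ≤ t (n + 1) := le_geomTimes_succ hs0.le hξ0.le
  have htq : ∀ n, t (n + 2) = (1 + ξ) * t (n + 1) := geomTimes_succ_succ s ξ
  have hdt : ∀ n, dt t (n + 2) = ξ * t (n + 1) := dt_geomTimes_succ_succ s ξ
  have hdtpos : ∀ n, 0 < dt t (n + 1) := dt_geomTimes_pos hs0 hξ0
  have hgrow : ∀ n, 1 ≤ n → 2 * t n ≤ t (n + 1) := by
    intro n hn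
    obtain ⟨k, rfl⟩ := Nat.exists_eq_add_of_le' hn
    rw [htq]
    nlinarith [ht0 (k + 1)]
  have hσpos : ∀ n, 0 < σ n := by
    intro n
    cases n with
    | zero => exact one_half_pos
    | succ n => exact Real.exp_pos _
  have hσlt : ∀ n, σ n < 1 := by
    intro n
    cases n with
    | zero => exact one_half_lt_one
    | succ n => exact (Real.exp_lt_exp.2 (by nlinarith [hdtpos n])).trans_eq Real.exp_zero
  have hσs : ∀ n, σ (n + 1) = Real.exp (-c * dt t (n + 1)) := fun n => rfl
  have hσb : ExpBdd t fun n => (σ n)⁻¹ := by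
    refine (expBdd_exp_dt ht0 (fun n hn => le_trans (by exact_mod_cast hn) (htn n)) hc0.le).mono
      fun n hn => ?_
    obtain ⟨k, rfl⟩ := Nat.exists_eq_add_of_le' hn
    rw [hσs, ← Real.exp_neg, neg_mul, neg_neg]
  have hexp : ∀ n, Real.exp ((1 - θ) * s) ≤
      Real.exp (dt t (n + 2) - θ * t (n + 2) - m * θ * t (n + 1)) := by
    intro n
    refine Real.exp_le_exp.2 ?_
    have e : dt t (n + 2) - θ * t (n + 2) - m * θ * t (n + 1) = 2 * (1 - θ) * t (n + 1) := by
      rw [hdt, htq, ← hξ]; ring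
    -- Half of the exponent `2(1-θ)t_{n+1}` would already suffice, since `t_{n+1} ≥ s`.
    rw [e]
    nlinarith [mul_le_mul_of_nonneg_left (hts n) hθ'.le, mul_nonneg hθ'.le (ht0 (n + 1))]
  have hA : ∀ n, An N F M t σ (n + 1) * (1 + ξ) ≤ 1 / 2 := by
    intro n
    have hcone : Real.exp (m * dt t (n + 2)) * σ (n + 1) ≤ Real.exp (-dt t (n + 2)) := by
      rw [hσs, ← Real.exp_add]
      refine Real.exp_le_exp.2 ?_
      have h1 : dt t (n + 2) ≤ (1 + ξ) * dt t (n + 1) := dt_geomTimes_le hs0 n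
      have h2 := mul_le_mul_of_nonneg_left h1 (by positivity : (0 : ℝ) ≤ m + 1)
      have h3 := mul_nonneg hχ0 (hdtpos n).le
      rw [hc]
      linarith
    have h1 := h.An_le hN (ht0 (n + 1)) (ht0 (n + 2)) hcone
    rw [Real.exp_neg] at h1
    have h2 := hX3.trans (hXs.trans (hexp n))
    set Y := Real.exp (dt t (n + 2) - θ * t (n + 2) - m * θ * t (n + 1)) with hY
    have hY0 : 0 < Y := Real.exp_pos _
    calc An N F M t σ (n + 1) * (1 + ξ) ≤ 2 * K ^ 2 * C ^ 2 * Y⁻¹ * (1 + ξ) :=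
          mul_le_mul_of_nonneg_right h1 (by linarith)
      _ = (4 * K ^ 2 * C ^ 2 * (1 + ξ)) / Y / 2 := by field_simp; norm_num
      _ ≤ 1 / 2 := div_le_div_of_nonneg_right ((div_le_one hY0).2 h2) (by norm_num)
  have hsmall : 4 * K ^ 4 * C ^ 2 ≤ Real.exp s :=
    hX1.trans (hXs.trans (Real.exp_le_exp.2 (by nlinarith)))
  have hww : ∀ n, width N F M t σ (n + 1) / Real.exp (((m : ℝ) + 1) * dt t (n + 1)) ≤
      width N F M t σ n / 2 := by
    intro n
    refine h.width_succ_le hN (ht0 n) (hσpos n) (hσpos _).le ?_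
    -- The initial width `σ_0 = 1/2` is not of exponential form; there `t_0 = 0`, and the size of
    -- `s` alone gives the inequality.
    cases n with
    | zero =>
      have e0 : t 0 = 0 := rfl
      have e1 : dt t 1 = s := dt_geomTimes_one s ξ
      have e2 : σ 0 = 1 / 2 := rfl
      have h1 : Real.exp s ≤ Real.exp (((m : ℝ) + 1) * s) := Real.exp_le_exp.2 (by nlinarith)
      rw [e0, e2, zero_add, e1, mul_zero, Real.exp_zero, mul_one]
      have h2 : 2 * K ^ 4 * C ^ 2 * σ 1 ≤ 2 * K ^ 4 * C ^ 2 * 1 := by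
        have := (hσlt 1).le
        gcongr
      linarith
    | succ n =>
      have h1 : t (n + 1) + dt t (n + 1) ≤ dt t (n + 2) := add_dt_geomTimes_le hs0 hξ2 n
      have h2 := mul_le_mul_of_nonneg_left h1 hc0.le
      have hcχ : χ + m * θ ≤ c := le_add_of_nonneg_left (by positivity)
      have h3 := mul_le_mul_of_nonneg_right hcχ (ht0 (n + 1))
      have h4 : s ≤ dt t (n + 2) := by linarith [hts n, hdtpos n]
      have h5 : 0 ≤ (m : ℝ) * dt t (n + 2) := mul_nonneg (by linarith) (hdtpos (n + 1)).le
      have h6 : 2 * K ^ 4 * C ^ 2 ≤ Real.exp s := by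
        have : 0 ≤ K ^ 4 * C ^ 2 := by positivity
        linarith
      rw [hσs, hσs]
      calc 2 * K ^ 4 * C ^ 2 *
            (Real.exp (-c * dt t (n + 1 + 1)) * Real.exp ((χ + m * θ) * t (n + 1)))
          ≤ Real.exp s *
            (Real.exp (-c * dt t (n + 1 + 1)) * Real.exp ((χ + m * θ) * t (n + 1))) := by gcongr
        _ = Real.exp (s + (-c * dt t (n + 2) + (χ + m * θ) * t (n + 1))) := by
            rw [Real.exp_add, Real.exp_add]
        _ ≤ Real.exp (-c * dt t (n + 1) + ((m : ℝ) + 1) * dt t (n + 2)) :=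
            Real.exp_le_exp.2 (by linarith)
        _ = _ := Real.exp_add _ _
  have hgM : gam M ≠ 0 := by
    rw [gam, hMγ]; exact hγ.ne'
  refine ⟨t, σ, rfl, hmono, ?_, ?_, ?_, fun n => ⟨hσpos n, hσlt n⟩, ?_, ?_, ?_⟩
  · exact Filter.tendsto_atTop_mono htn tendsto_natCast_atTop_atTop
  · intro n hn
    refine h.Pn_ne hm (ht0 n) (ht0 _) (hX2.trans_le (hXs.trans ?_))
    obtain ⟨k, rfl⟩ := Nat.exists_eq_add_of_le' hn
    cases k with
    | zero =>
      have e0 : t 0 = 0 := rfl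
      have e1 : dt t 1 = s := dt_geomTimes_one s ξ
      have e2 : t 1 = s := by simp [ht, geomTimes]
      simp only [zero_add, Nat.sub_self, e0, e1, e2]
      exact Real.exp_le_exp.2 (by linarith)
    | succ k => exact hexp k
  · intro n hn
    obtain ⟨k, rfl⟩ := Nat.exists_eq_add_of_le' hn
    exact hdt k
  · intro n hn
    obtain ⟨k, rfl⟩ := Nat.exists_eq_add_of_le' hn
    exact hσs k
  · exact fun n => Thetan_pos hN (h.gamn_ne_zero (ht0 n)) (hσpos n) hν hlam
      (h.width_pos hN (ht0 n) (hσpos n)) (hww n)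
  · exact calB_lt_top (fun n => hs1.trans (hts n)) (by linarith) htq hA
      (h.expBdd_phin hN hgM ht0 (fun n _ => htn n) hmono.monotone hgrow hσpos hσlt hσb hν hδ hlam
        hlam1 hww)
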